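/- Let $A$ be a $2\times 2$ integer matrix with $\det A=\pm1$ and no eigenvalue on the unit circle, and let $f_A(x)=Ax \bmod 1$ be the corresponding hyperbolic CAT map of $\mathbb T^2=\mathbb R^2/\mathbb Z^2$. For a volume-preserving $C^\infty$ diffeomorphism $f$ of $\mathbb T^2$ and $\kappa>0$ put $\mathcal L_{f,\kappa}\varphi=e^{\kappa\Delta}(\varphi\circ f^{-1})$, where $e^{t\Delta}$ is the heat semigroup, and for $k_0\in\mathbb Z^2\setminus\{0\}$ let $\varphi_n=\mathcal L_{f,\kappa}^n e_{k_0}$ with $e_{k}(x)=e^{2\pi i k\cdot x}$. For $0\ne\varphi\in L^2(\mathbb T^2)$ let $X_\varphi$ be a $\mathbb Z^2$-valued random variable with $\mathbb P(X_\varphi=k)=|\hat\varphi(k)|^2/\|\varphi\|_{L^2}^2$; its mean $\mathbb E X_\varphi=\sum_k k\,\mathbb P(X_\varphi=k)$ and variance $\operatorname{Var}(X_\varphi)=\sum_k|k-\mathbb E X_\varphi|^2\,\mathbb P(X_\varphi=k)$ are the spectral centroid and the spectral variance of $\varphi$. Let $$d_{C^\infty}(f,g)=\sum_{k\ge0}2^{-k}\frac{d_{C^k}(f,g)}{1+d_{C^k}(f,g)},$$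 where $d_{C^0}$ is the uniform distance and $d_{C^k}(f,g)=\max\{d_{C^{k-1}}(f,g),\ \sup_x\|D^kf(x)-D^kg(x)\|\}$ for $k\ge1$. Then there are constants $M>1$ and $c>0$, depending only on $A$, such that for every $k_0\in\mathbb Z^2\setminus\{0\}$ there are $\eta_0>0$ and $C>0$, depending only on $A$ and $k_0$, with the following property. For all $\epsilon,\kappa\in(0,\eta_0]$, every volume-preserving $C^\infty$ diffeomorphism $f$ of $\mathbb T^2$ with $d_{C^\infty}(f,f_A)\le\epsilon$, and every integer $n\ge0$ with $n\le c\,(|\log\kappa|+1)$, the function $\varphi_n$ is a nonzero element of $L^2$, $X_{\varphi_n}$ has a finite second moment, and $$\bigl|\mathbb E X_{\varphi_n}-(A^{-T})^nk_0\bigr|\le C\max\{\kappa,\epsilon\}M^n,\qquad \operatorname{Var}(X_{\varphi_n})\le C\max\{\kappa,\epsilon\}M^n .$$ -/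

import Mathlib

open scoped ContDiff

noncomputable section

namespace PulseCat

/-- The two-dimensional torus `ℝ² / ℤ²`. -/
abbrev Torus := UnitAddTorus (Fin 2)

/-- The Euclidean plane. -/
abbrev Plane := EuclideanSpace ℝ (Fin 2)

/-- Wavenumbers. -/
abbrev Wave := Fin 2 → ℤ

/-- The normalized Lebesgue (Haar) measure on the torus; it is the measure with respect to which
`UnitAddTorus.mFourierCoeff` is defined. -/
def torusMeasure : MeasureTheory.Measure Torus :=
  MeasureTheory.Measure.pi fun _ => AddCircle.haarAddCircle

/-- The covering map `ℝ² → ℝ² / ℤ²`. -/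
def cover (x : Plane) : Torus := fun i => ((x i : ℝ) : UnitAddCircle)

/-- A wavenumber as a vector of the Euclidean plane. -/
def waveVec (k : Wave) : Plane := WithLp.toLp 2 fun i => (k i : ℝ)

/-! ### Smooth maps of the torus and the `C^∞` distance -/

/-- `F : ℝ² → ℝ²` is a smooth lift of `f : 𝕋² → 𝕋²`. -/
def IsSmoothLift (F : Plane → Plane) (f : Torus → Torus) : Prop :=
  ContDiff ℝ ∞ F ∧ ∀ x, cover (F x) = f (cover x)

/-- A map of the torus is `C^∞` when it has a `C^∞` lift to the universal cover `ℝ²`. -/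
def IsSmooth (f : Torus → Torus) : Prop := ∃ F, IsSmoothLift F f

/-- `C^∞` diffeomorphisms of the torus. -/
def IsSmoothDiffeo (f : Torus ≃ Torus) : Prop := IsSmooth f ∧ IsSmooth f.symm

/-- A smooth lift of a smooth map of the torus. -/
def lift (f : Torus → Torus) : Plane → Plane := Classical.epsilon fun F => IsSmoothLift F f

/-- The `k`-th derivative `D^k f` of a smooth map of the torus (for `1 ≤ k`), as a function on the
universal cover. By `iteratedFDeriv_eq_of_isSmoothLift` it does not depend on the lift. -/
def torusDeriv (k : ℕ) (f : Torus → Torus) (x : Plane) :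
    ContinuousMultilinearMap ℝ (fun _ : Fin k => Plane) Plane :=
  iteratedFDeriv ℝ k (lift f) x

theorem isSmoothLift_lift {f : Torus → Torus} (hf : IsSmooth f) : IsSmoothLift (lift f) f :=
  Classical.epsilon_spec hf

theorem exists_const_of_isSmoothLift {F G : Plane → Plane} {f : Torus → Torus}
    (hF : IsSmoothLift F f) (hG : IsSmoothLift G f) : ∃ c : Plane, F = fun x => G x + c := by
  have key : ∀ i : Fin 2, ∀ x y : Plane, F x i - G x i = F y i - G y i := by
    intro i x y
    have hcF : Continuous F := hF.1.continuous
    have hcG : Continuous G := hG.1.continuous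
    have hc : Continuous fun x : Plane => F x i - G x i := by fun_prop
    have hd : DiscreteTopology (Set.range ((↑) : ℤ → ℝ)) :=
      Int.isClosedEmbedding_coe_real.toIsEmbedding.toHomeomorph.symm.isEmbedding.discreteTopology
    refine isPreconnected_univ.constant_of_mapsTo (T := Set.range ((↑) : ℤ → ℝ))
      hd.isDiscrete hc.continuousOn ?_ (Set.mem_univ x) (Set.mem_univ y)
    intro z _
    have h : cover (F z) i = cover (G z) i := by rw [hF.2, hG.2]
    have h' : ((F z i - G z i : ℝ) : UnitAddCircle) = 0 := by
      rw [AddCircle.coe_sub]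
      exact sub_eq_zero.2 h
    obtain ⟨m, hm⟩ := (AddCircle.coe_eq_zero_iff (1 : ℝ)).1 h'
    exact ⟨m, by simpa using hm⟩
  refine ⟨F 0 - G 0, funext fun x => ?_⟩
  ext i
  have := key i x 0
  simp only [PiLp.add_apply, PiLp.sub_apply]
  linarith

theorem iteratedFDeriv_eq_of_isSmoothLift {F G : Plane → Plane} {f : Torus → Torus}
    (hF : IsSmoothLift F f) (hG : IsSmoothLift G f) (k : ℕ) (x : Plane) :
    iteratedFDeriv ℝ (k + 1) F x = iteratedFDeriv ℝ (k + 1) G x := by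
  obtain ⟨c, rfl⟩ := exists_const_of_isSmoothLift hF hG
  have h : (fderiv ℝ fun y => G y + c) = fderiv ℝ G := by
    funext y
    exact fderiv_add_const c
  rw [iteratedFDeriv_succ_eq_comp_right, iteratedFDeriv_succ_eq_comp_right]
  simp only [Function.comp_apply, h]

/-- The uniform distance, for the flat metric of the torus. -/
def c0Dist (f g : Torus → Torus) : ℝ := ⨆ x, √(∑ i, ‖f x i - g x i‖ ^ 2)

/-- The `C^k` distance `d_{C^k}`. -/
def cDist (f g : Torus → Torus) : ℕ → ℝ
  | 0 => c0Dist f g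
  | k + 1 => max (cDist f g k) (⨆ x, ‖torusDeriv (k + 1) f x - torusDeriv (k + 1) g x‖)

/-- The `C^∞` distance `∑ 2^{-k} d_{C^k} / (1 + d_{C^k})`. -/
def cInftyDist (f g : Torus → Torus) : ℝ :=
  ∑' k : ℕ, (1 / 2 : ℝ) ^ k * (cDist f g k / (1 + cDist f g k))

/-! ### CAT maps -/

/-- `A` has determinant `±1` and no (complex) eigenvalue on the unit circle. -/
def IsHyperbolic (A : Matrix (Fin 2) (Fin 2) ℤ) : Prop :=
  (A.det = 1 ∨ A.det = -1) ∧
    ∀ μ : ℂ, Module.End.HasEigenvalue (Matrix.toLin' (A.map (Int.cast : ℤ → ℂ))) μ → ‖μ‖ ≠ 1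

/-- The map `x ↦ A x mod 1` of the torus. -/
def catMap (A : Matrix (Fin 2) (Fin 2) ℤ) (x : Torus) : Torus := fun i => ∑ j, A i j • x j

/-! ### Transfer operators and pulses -/

/-- The transfer operator `φ ↦ φ ∘ f⁻¹`. -/
def transfer (f : Torus ≃ Torus) (φ : Torus → ℂ) : Torus → ℂ := fun x => φ (f.symm x)

/-- The heat semigroup `e^{tΔ}`, for `t > 0`: the mode `x ↦ exp (2πi k·x)` is an eigenfunction of
`Δ` for the eigenvalue `-4π²|k|²`. -/
def heat (t : ℝ) (φ : Torus → ℂ) : Torus → ℂ := fun x =>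
  ∑' k : Wave, (Real.exp (-(4 * Real.pi ^ 2 * ‖waveVec k‖ ^ 2 * t)) : ℂ) *
    UnitAddTorus.mFourierCoeff φ k * UnitAddTorus.mFourier k x

/-- The operator `e^{κΔ} ∘ L_f`. -/
def diffusiveTransfer (f : Torus ≃ Torus) (κ : ℝ) (φ : Torus → ℂ) : Torus → ℂ :=
  heat κ (transfer f φ)

/-- The pulse `φ_n`, the `n`-th iterate of `e^{κΔ} ∘ L_f` applied to the Fourier mode `k₀`. -/
def pulse (f : Torus ≃ Torus) (κ : ℝ) (k₀ : Wave) (n : ℕ) : Torus → ℂ :=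
  (diffusiveTransfer f κ)^[n] fun x => UnitAddTorus.mFourier k₀ x

/-! ### Spectral distributions -/

/-- The squared `L²` norm. -/
def l2NormSq (φ : Torus → ℂ) : ℝ := ∫ x, ‖φ x‖ ^ 2 ∂torusMeasure

/-- The mass at `k` of the spectral distribution of `φ`. -/
def spectralMass (φ : Torus → ℂ) (k : Wave) : ℝ :=
  ‖UnitAddTorus.mFourierCoeff φ k‖ ^ 2 / l2NormSq φ

/-- The spectral centroid. -/
def centroid (φ : Torus → ℂ) : Plane := ∑' k : Wave, spectralMass φ k • waveVec k

/-- The spectral variance. -/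
def spectralVariance (φ : Torus → ℂ) : ℝ :=
  ∑' k : Wave, ‖waveVec k - centroid φ‖ ^ 2 * spectralMass φ k

/-- The spectral distribution of `φ` is defined and has a finite second moment, so that the series
of the centroid and of the variance converge. -/
def HasSpectralMoments (φ : Torus → ℂ) : Prop :=
  MeasureTheory.MemLp φ 2 torusMeasure ∧ 0 < l2NormSq φ ∧
    Summable fun k : Wave => ‖waveVec k‖ ^ 2 * spectralMass φ k

end PulseCat

end

namespace PulseCat

open MeasureTheory UnitAddTorus

/-! For the exact CAT map, transfer permutes Fourier modes and the heat flow rescales them, so the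
pulse is a multiple of the single mode `k n = (A^{-T})^n k₀`. The proof compares the perturbed pulse
with a multiple `a` of that mode in the squared H¹ seminorm (`GradBound`). Heat multiplies every
coefficient by at most 1, and its effect on the comparison mode is absorbed into `a`, so diffusion
contributes no error. Transfer enlarges the existing error by a fixed factor (`GradBound.transfer`).
Replacing `f_A` by `f` adds O(ε²) times a power, because the two images of a mode differ by a
function with Lipschitz constant O(ε) (`gradBound_mode_transfer_sub`). Induction gives an error `E
ε² W^n` (`exists_gradBound_pulse_sub`).

Two facts turn this into moments. Transfer preserves the L² norm and heat loses O(κ R^n) of it at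
step n, so the squared norm stays above 1/2 for n up to a multiple of |log κ|; this is where the
bound on n is used. The zero mode, invisible to gradients, stays empty because `f` preserves volume.
Hence the second moment about `k n` is O(|k n|² ε² W^n). It dominates the variance, and also the
displacement of the centroid, since nonzero integer vectors have length at least 1.

Boundedness of transfer in H¹ needs only that `f⁻¹` is Lipschitz and measure preserving: the
seminorm is comparable to the L² modulus of continuity `‖g(· + h) - g‖² ≤ K ‖h‖²`, whose average
over a ball of shifts is a double integral over close pairs of points, and `f⁻¹` keeps close pairs
close. -/

/-! ### Fourier coefficients of continuous functions -/

instance : IsProbabilityMeasure torusMeasure := by unfold torusMeasure; infer_instance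

instance : torusMeasure.IsAddHaarMeasure := by unfold torusMeasure; infer_instance

theorem integrable_of_continuous {E : Type*} [NormedAddCommGroup E] {g : Torus → E}
    (hg : Continuous g) : Integrable g torusMeasure :=
  hg.integrable_of_hasCompactSupport (HasCompactSupport.of_compactSpace g)

theorem mFourierCoeff_eq (g : Torus → ℂ) (k : Wave) :
    mFourierCoeff g k = ∫ x, mFourier (-k) x * g x ∂torusMeasure := rfl

/-- Parseval's identity for continuous functions. -/
theorem hasSum_sq_mFourierCoeff_of_continuous {g : Torus → ℂ} (hg : Continuous g) :
    HasSum (fun k => ‖mFourierCoeff g k‖ ^ 2) (l2NormSq g) := by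
  have h := hasSum_sq_mFourierCoeff
    (ContinuousMap.toLp (E := ℂ) 2 torusMeasure ℂ (⟨g, hg⟩ : C(Torus, ℂ)))
  have e : ∫ x, ‖(ContinuousMap.toLp (E := ℂ) 2 torusMeasure ℂ (⟨g, hg⟩ : C(Torus, ℂ))) x‖ ^ 2
      ∂torusMeasure = l2NormSq g := by
    apply integral_congr_ae
    filter_upwards [ContinuousMap.coeFn_toLp (p := 2) (𝕜 := ℂ) torusMeasure
      (⟨g, hg⟩ : C(Torus, ℂ))] with x hx
    rw [hx]; rfl
  rw [← e]
  refine h.congr_fun fun k => ?_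
  exact congrArg (fun z : ℂ => ‖z‖ ^ 2) (mFourierCoeff_toLp (⟨g, hg⟩ : C(Torus, ℂ)) k).symm

theorem mFourierCoeff_sub {g h : Torus → ℂ} (hg : Continuous g) (hh : Continuous h) (k : Wave) :
    mFourierCoeff (fun x => g x - h x) k = mFourierCoeff g k - mFourierCoeff h k := by
  simp only [mFourierCoeff_eq, mul_sub]
  exact integral_sub (integrable_of_continuous (by fun_prop))
    (integrable_of_continuous (by fun_prop))

theorem mFourierCoeff_add {g h : Torus → ℂ} (hg : Continuous g) (hh : Continuous h) (k : Wave) :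
    mFourierCoeff (fun x => g x + h x) k = mFourierCoeff g k + mFourierCoeff h k := by
  simp only [mFourierCoeff_eq, mul_add]
  exact integral_add (integrable_of_continuous (by fun_prop))
    (integrable_of_continuous (by fun_prop))

theorem mFourierCoeff_const_mul (c : ℂ) (g : Torus → ℂ) (k : Wave) :
    mFourierCoeff (fun x => c * g x) k = c * mFourierCoeff g k := by
  simp only [mFourierCoeff_eq, ← integral_const_mul]
  congr 1; ext x; ring

theorem mFourierCoeff_zero_eq_integral (g : Torus → ℂ) :
    mFourierCoeff g 0 = ∫ x, g x ∂torusMeasure := by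
  simp [mFourierCoeff_eq, mFourier_zero]

theorem mFourier_apply_add (k : Wave) (x y : Torus) :
    mFourier k (x + y) = mFourier k x * mFourier k y := by
  simp [mFourier, fourier_apply, AddCircle.toCircle_add, smul_add]
  ring

theorem norm_mFourier_apply (k : Wave) (x : Torus) : ‖mFourier k x‖ = 1 := by
  simp [mFourier, fourier_apply, Circle.norm_coe]

theorem mFourierCoeff_translate (g : Torus → ℂ) (h : Torus) (k : Wave) :
    mFourierCoeff (fun x => g (x + h)) k = mFourier k h * mFourierCoeff g k := by
  simp only [mFourierCoeff_eq, ← integral_const_mul]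
  rw [← integral_add_right_eq_self (fun x => mFourier k h * (mFourier (-k) x * g x)) h]
  congr 1; ext x
  have h1 : mFourier k h * mFourier (-k) h = 1 := by
    rw [← mFourier_add]; simp [mFourier_zero]
  rw [mFourier_apply_add]
  linear_combination (-(mFourier (-k) x * g (x + h))) * h1

theorem mFourierCoeff_mFourier (k₀ k : Wave) :
    mFourierCoeff (fun x => mFourier k₀ x) k = if k = k₀ then 1 else 0 := by
  have h := (orthonormal_iff_ite.mp (orthonormal_mFourier (d := Fin 2))) k k₀
  rw [← h, ContinuousMap.inner_toLp]
  simp only [← mFourier_neg, mFourierCoeff, smul_eq_mul, mul_comm]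

theorem norm_mFourierCoeff_le {g : Torus → ℂ} (k : Wave) :
    ‖mFourierCoeff g k‖ ≤ ∫ x, ‖g x‖ ∂torusMeasure := by
  rw [mFourierCoeff_eq]
  refine (norm_integral_le_integral_norm _).trans_eq ?_
  simp [norm_mFourier_apply]

theorem continuous_fourierSeries {c : Wave → ℂ} (hc : Summable fun k => ‖c k‖) :
    Continuous fun x : Torus => ∑' k, c k * mFourier k x :=
  continuous_tsum (fun k => by fun_prop) hc fun k x => by
    rw [norm_mul, norm_mFourier_apply, mul_one]

theorem mFourierCoeff_fourierSeries {c : Wave → ℂ} (hc : Summable fun k => ‖c k‖) (k : Wave) :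
    mFourierCoeff (fun x : Torus => ∑' l, c l * mFourier l x) k = c k := by
  have e : ∀ l, ∫ x, mFourier (-k) x * (c l * mFourier l x) ∂torusMeasure
      = c l * if k = l then 1 else 0 := by
    intro l
    rw [← mFourierCoeff_mFourier, ← mFourierCoeff_const_mul, mFourierCoeff_eq]
  have h := hasSum_integral_of_summable_integral_norm (μ := torusMeasure)
    (F := fun l x => mFourier (-k) x * (c l * mFourier l x))
    (fun l => integrable_of_continuous (by fun_prop))
    (by simpa [norm_mFourier_apply] using hc)
  simp only [e, mul_ite, mul_one, mul_zero] at h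
  rw [mFourierCoeff_eq]
  simp only [← tsum_mul_left]
  rw [← h.tsum_eq]
  rw [tsum_eq_single k (fun l hl => if_neg hl.symm), if_pos rfl]

/-! ### The heat semigroup on the Fourier side -/

theorem norm_waveVec_sq (k : Wave) : ‖waveVec k‖ ^ 2 = (k 0 : ℝ) ^ 2 + (k 1 : ℝ) ^ 2 := by
  simp [EuclideanSpace.norm_sq_eq, waveVec]

theorem summable_exp_neg_int_sq {c : ℝ} (hc : 0 < c) :
    Summable fun n : ℤ => Real.exp (-(c * (n : ℝ) ^ 2)) := by
  have h : Summable fun n : ℕ => Real.exp (-(c * (n : ℝ) ^ 2)) := by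
    refine Summable.of_nonneg_of_le (fun _ => (Real.exp_pos _).le) (fun n => ?_)
      (Real.summable_exp_nat_mul_iff.2 (neg_lt_zero.2 hc))
    refine Real.exp_le_exp.2 ?_
    have : (n : ℝ) ≤ (n : ℝ) ^ 2 := by exact_mod_cast Nat.le_self_pow two_ne_zero n
    nlinarith
  refine Summable.of_nat_of_neg (by simpa using h) (by simpa using h)

/-- The damping factor of the heat semigroup on the mode `k`. -/
noncomputable def damp (t : ℝ) (k : Wave) : ℝ :=
  Real.exp (-(4 * Real.pi ^ 2 * ‖waveVec k‖ ^ 2 * t))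

theorem damp_pos (t : ℝ) (k : Wave) : 0 < damp t k := Real.exp_pos _

theorem damp_le_one {t : ℝ} (ht : 0 ≤ t) (k : Wave) : damp t k ≤ 1 :=
  Real.exp_le_one_iff.2 (neg_nonpos.2 (by positivity))

theorem summable_damp {t : ℝ} (ht : 0 < t) : Summable (damp t) := by
  have h := summable_exp_neg_int_sq (c := 4 * Real.pi ^ 2 * t) (by positivity)
  have h2 := h.mul_of_nonneg h (fun _ => (Real.exp_pos _).le) (fun _ => (Real.exp_pos _).le)
  rw [← (finTwoArrowEquiv ℤ).summable_iff] at h2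
  refine h2.congr fun k => ?_
  change Real.exp (-(4 * Real.pi ^ 2 * t * (k 0 : ℝ) ^ 2)) *
    Real.exp (-(4 * Real.pi ^ 2 * t * (k 1 : ℝ) ^ 2)) = _
  simp only [damp, norm_waveVec_sq, ← Real.exp_add]
  congr 1; ring

theorem summable_norm_damp_mul {t : ℝ} (ht : 0 < t) (g : Torus → ℂ) :
    Summable fun k => ‖(damp t k : ℂ) * mFourierCoeff g k‖ := by
  refine Summable.of_nonneg_of_le (fun _ => norm_nonneg _) (fun k => ?_)
    ((summable_damp ht).mul_right (∫ x, ‖g x‖ ∂torusMeasure))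
  rw [norm_mul, Complex.norm_real, Real.norm_of_nonneg (damp_pos t k).le]
  exact mul_le_mul_of_nonneg_left (norm_mFourierCoeff_le k) (damp_pos t k).le

theorem continuous_heat {t : ℝ} (ht : 0 < t) (g : Torus → ℂ) : Continuous (heat t g) :=
  continuous_fourierSeries (summable_norm_damp_mul ht g)

theorem mFourierCoeff_heat {t : ℝ} (ht : 0 < t) (g : Torus → ℂ) (k : Wave) :
    mFourierCoeff (heat t g) k = damp t k * mFourierCoeff g k :=
  mFourierCoeff_fourierSeries (summable_norm_damp_mul ht g) k

/-! ### The H¹ seminorm -/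

/-- The squared `L²` norm of the gradient of `g` is at most `4π²Q`, expressed through finite
partial sums over the Fourier side. -/
def GradBound (g : Torus → ℂ) (Q : ℝ) : Prop :=
  ∀ S : Finset Wave, ∑ k ∈ S, ‖waveVec k‖ ^ 2 * ‖mFourierCoeff g k‖ ^ 2 ≤ Q

theorem GradBound.nonneg {g : Torus → ℂ} {Q : ℝ} (h : GradBound g Q) : 0 ≤ Q := by
  simpa using h ∅

theorem GradBound.mono {g : Torus → ℂ} {Q R : ℝ} (h : GradBound g Q) (hQ : Q ≤ R) :
    GradBound g R := fun S => (h S).trans hQ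

theorem GradBound.summable {g : Torus → ℂ} {Q : ℝ} (h : GradBound g Q) :
    Summable fun k => ‖waveVec k‖ ^ 2 * ‖mFourierCoeff g k‖ ^ 2 :=
  summable_of_sum_le (fun _ => by positivity) h

theorem GradBound.tsum_le {g : Torus → ℂ} {Q : ℝ} (h : GradBound g Q) :
    ∑' k, ‖waveVec k‖ ^ 2 * ‖mFourierCoeff g k‖ ^ 2 ≤ Q :=
  h.summable.tsum_le_of_sum_le h

theorem GradBound.of_norm_le {g h : Torus → ℂ} {Q : ℝ} (hg : GradBound g Q)
    (hh : ∀ k, ‖mFourierCoeff h k‖ ≤ ‖mFourierCoeff g k‖) : GradBound h Q := fun S =>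
  (Finset.sum_le_sum fun k _ => by gcongr; exact hh k).trans (hg S)

theorem GradBound.add {g h : Torus → ℂ} {Q R : ℝ} (hg : GradBound g Q) (hh : GradBound h R)
    (cg : Continuous g) (ch : Continuous h) :
    GradBound (fun x => g x + h x) (2 * Q + 2 * R) := fun S => by
  have h1 : ∀ k, ‖waveVec k‖ ^ 2 * ‖mFourierCoeff (fun x => g x + h x) k‖ ^ 2 ≤
      2 * (‖waveVec k‖ ^ 2 * ‖mFourierCoeff g k‖ ^ 2) +
      2 * (‖waveVec k‖ ^ 2 * ‖mFourierCoeff h k‖ ^ 2) := fun k => by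
    rw [mFourierCoeff_add cg ch]
    have h2 : ‖mFourierCoeff g k + mFourierCoeff h k‖ ^ 2 ≤
        2 * ‖mFourierCoeff g k‖ ^ 2 + 2 * ‖mFourierCoeff h k‖ ^ 2 := by
      nlinarith [norm_add_le (mFourierCoeff g k) (mFourierCoeff h k),
        norm_nonneg (mFourierCoeff g k + mFourierCoeff h k),
        sq_nonneg (‖mFourierCoeff g k‖ - ‖mFourierCoeff h k‖)]
    nlinarith [sq_nonneg ‖waveVec k‖]
  refine (Finset.sum_le_sum fun k _ => h1 k).trans ?_
  rw [Finset.sum_add_distrib, ← Finset.mul_sum, ← Finset.mul_sum]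
  linarith [hg S, hh S]

/-! ### The L² modulus of continuity and its equivalence with the seminorm -/

theorem exists_coe_eq_abs_eq_norm (x : UnitAddCircle) :
    ∃ t : ℝ, (t : UnitAddCircle) = x ∧ |t| = ‖x‖ := by
  obtain ⟨s, rfl⟩ := QuotientAddGroup.mk_surjective x
  refine ⟨s - round s, ?_, ?_⟩
  · rw [AddCircle.coe_sub, sub_eq_self]
    exact (AddCircle.coe_eq_zero_iff (1 : ℝ)).2 ⟨round s, by simp⟩
  · exact UnitAddCircle.norm_eq.symm

theorem norm_coe_le_abs (t : ℝ) : ‖(t : UnitAddCircle)‖ ≤ |t| := by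
  rw [UnitAddCircle.norm_eq]
  simpa using round_le t 0

/-- The exact chord length yields both the upper bound and, through Jordan's inequality, the lower
bound on `‖mFourier k h - 1‖`. -/
theorem norm_fourier_coe_sub_one (n : ℤ) (t : ℝ) :
    ‖fourier n (t : UnitAddCircle) - 1‖ = |2 * Real.sin (Real.pi * (n * t))| := by
  have := Complex.norm_exp_I_mul_ofReal_sub_one (2 * (Real.pi * (n * t)))
  rw [mul_div_cancel_left₀ _ (two_ne_zero' ℝ)] at this
  rw [fourier_coe_apply, ← Real.norm_eq_abs, ← this]
  congr 3
  push_cast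
  ring

theorem norm_fourier_sub_one_le (n : ℤ) (x : UnitAddCircle) :
    ‖fourier n x - 1‖ ≤ 2 * Real.pi * |(n : ℝ)| * ‖x‖ := by
  obtain ⟨t, rfl, ht⟩ := exists_coe_eq_abs_eq_norm x
  rw [norm_fourier_coe_sub_one, ← ht, abs_mul, abs_two]
  have := Real.abs_sin_le_abs (x := Real.pi * (n * t))
  rw [abs_mul, abs_mul, abs_of_pos Real.pi_pos] at this
  linarith

theorem norm_mFourier_sub_one_le (k : Wave) (x : Torus) :
    ‖mFourier k x - 1‖ ≤ 2 * Real.pi * (|(k 0 : ℝ)| + |(k 1 : ℝ)|) * ‖x‖ := by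
  have e : mFourier k x = fourier (k 0) (x 0) * fourier (k 1) (x 1) := by simp [mFourier]
  have e2 : mFourier k x - 1 =
      fourier (k 0) (x 0) * (fourier (k 1) (x 1) - 1) + (fourier (k 0) (x 0) - 1) := by
    rw [e]; ring
  rw [e2]
  refine (norm_add_le _ _).trans ?_
  rw [norm_mul]
  have h0 : ‖(fourier (k 0) (x 0) : ℂ)‖ = 1 := by simp [fourier_apply, Circle.norm_coe]
  have h1 := norm_fourier_sub_one_le (k 0) (x 0)
  have h2 := norm_fourier_sub_one_le (k 1) (x 1)
  have h3 : 2 * Real.pi * |(k 0 : ℝ)| * ‖x 0‖ ≤ 2 * Real.pi * |(k 0 : ℝ)| * ‖x‖ := by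
    gcongr; exact norm_le_pi_norm x 0
  have h4 : 2 * Real.pi * |(k 1 : ℝ)| * ‖x 1‖ ≤ 2 * Real.pi * |(k 1 : ℝ)| * ‖x‖ := by
    gcongr; exact norm_le_pi_norm x 1
  rw [h0]
  linarith

theorem sq_sum_abs_le (k : Wave) :
    (|(k 0 : ℝ)| + |(k 1 : ℝ)|) ^ 2 ≤ 2 * ‖waveVec k‖ ^ 2 := by
  rw [norm_waveVec_sq, ← sq_abs (k 0 : ℝ), ← sq_abs (k 1 : ℝ)]
  nlinarith [sq_nonneg (|(k 0 : ℝ)| - |(k 1 : ℝ)|)]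

theorem norm_mFourier_sub_one_sq_le (k : Wave) (x : Torus) :
    ‖mFourier k x - 1‖ ^ 2 ≤ 8 * Real.pi ^ 2 * ‖waveVec k‖ ^ 2 * ‖x‖ ^ 2 := by
  calc ‖mFourier k x - 1‖ ^ 2
      ≤ (2 * Real.pi * (|(k 0 : ℝ)| + |(k 1 : ℝ)|) * ‖x‖) ^ 2 := by
        gcongr; exact norm_mFourier_sub_one_le k x
    _ = 4 * Real.pi ^ 2 * ‖x‖ ^ 2 * (|(k 0 : ℝ)| + |(k 1 : ℝ)|) ^ 2 := by ring
    _ ≤ 4 * Real.pi ^ 2 * ‖x‖ ^ 2 * (2 * ‖waveVec k‖ ^ 2) := by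
        gcongr; exact sq_sum_abs_le k
    _ = _ := by ring

/-- The squared `L²` norm of a difference of `g`. -/
noncomputable def shiftSq (g : Torus → ℂ) (h : Torus) : ℝ := l2NormSq fun x => g (x + h) - g x

theorem hasSum_shiftSq {g : Torus → ℂ} (hg : Continuous g) (h : Torus) :
    HasSum (fun k => ‖mFourier k h - 1‖ ^ 2 * ‖mFourierCoeff g k‖ ^ 2) (shiftSq g h) := by
  have H := hasSum_sq_mFourierCoeff_of_continuous (g := fun x => g (x + h) - g x) (by fun_prop)
  refine H.congr_fun fun k => ?_
  rw [mFourierCoeff_sub (by fun_prop) hg, mFourierCoeff_translate, ← mul_pow, ← norm_mul]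
  ring_nf

theorem GradBound.shiftSq_le {g : Torus → ℂ} {Q : ℝ} (hQ : GradBound g Q) (hg : Continuous g)
    (h : Torus) : shiftSq g h ≤ 8 * Real.pi ^ 2 * Q * ‖h‖ ^ 2 := by
  have H := hasSum_shiftSq hg h
  calc shiftSq g h = _ := H.tsum_eq.symm
    _ ≤ ∑' k, 8 * Real.pi ^ 2 * ‖h‖ ^ 2 * (‖waveVec k‖ ^ 2 * ‖mFourierCoeff g k‖ ^ 2) := by
        refine H.summable.tsum_le_tsum (fun k => ?_) (hQ.summable.mul_left _)
        have := norm_mFourier_sub_one_sq_le k h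
        nlinarith [sq_nonneg ‖mFourierCoeff g k‖]
    _ ≤ 8 * Real.pi ^ 2 * ‖h‖ ^ 2 * Q := by
        rw [tsum_mul_left]; gcongr; exact hQ.tsum_le
    _ = _ := by ring

/-- A mode detects a small shift along a coordinate axis. -/
theorem sq_le_norm_mFourier_single_sub_one_sq (k : Wave) (i : Fin 2) {s : ℝ}
    (hs : |(k i : ℝ) * s| ≤ 1 / 2) :
    16 * s ^ 2 * (k i : ℝ) ^ 2 ≤
      ‖mFourier k (Pi.single i (s : UnitAddCircle) : Torus) - 1‖ ^ 2 := by
  have e : mFourier k (Pi.single i (s : UnitAddCircle) : Torus) = fourier (k i) (s : UnitAddCircle) := by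
    fin_cases i <;> simp [mFourier]
  rw [e, norm_fourier_coe_sub_one, sq_abs]
  have h1 : 2 / Real.pi * (Real.pi * |(k i : ℝ) * s|) ≤ Real.sin (Real.pi * |(k i : ℝ) * s|) :=
    Real.mul_le_sin (by positivity) (by nlinarith [Real.pi_pos])
  have h2 : 2 / Real.pi * (Real.pi * |(k i : ℝ) * s|) = 2 * |(k i : ℝ) * s| := by
    field_simp
  have h3 : Real.sin (Real.pi * |(k i : ℝ) * s|) ^ 2 = Real.sin (Real.pi * (k i * s)) ^ 2 := by
    rcases abs_choice ((k i : ℝ) * s) with h | h <;> rw [h]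
    rw [mul_neg, Real.sin_neg, neg_sq]
  have h4 : (2 * |(k i : ℝ) * s|) ^ 2 ≤ Real.sin (Real.pi * |(k i : ℝ) * s|) ^ 2 := by
    rw [← h2]; gcongr
  rw [h3, mul_pow, sq_abs] at h4
  nlinarith

/-- By Parseval, a shift by `s` along axis `i` weighs mode `k` by at least `16 s² k_i²` once `|k_i
s| ≤ 1/2`. A finite set of modes admits one such `s`, and dividing by `s²` leaves a bound
independent of the set. -/
theorem gradBound_of_shiftSq_le {g : Torus → ℂ} {K : ℝ} (hg : Continuous g)
    (hK : ∀ h, shiftSq g h ≤ K * ‖h‖ ^ 2) : GradBound g K := by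
  intro S
  obtain ⟨N, hN⟩ : ∃ N : ℝ, ∀ k ∈ S, |(k 0 : ℝ)| + |(k 1 : ℝ)| ≤ N := by
    refine ⟨∑ k ∈ S, (|(k 0 : ℝ)| + |(k 1 : ℝ)|), fun k hk => ?_⟩
    exact Finset.single_le_sum (f := fun k : Wave => |(k 0 : ℝ)| + |(k 1 : ℝ)|)
      (fun _ _ => by positivity) hk
  have hs : (0 : ℝ) < 1 / (2 * (|N| + 1)) := by positivity
  set s : ℝ := 1 / (2 * (|N| + 1)) with hs_def
  have key : ∀ i : Fin 2, ∑ k ∈ S, 16 * ((k i : ℝ) ^ 2 * ‖mFourierCoeff g k‖ ^ 2) ≤ K := by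
    intro i
    set v : Torus := Pi.single i (s : UnitAddCircle)
    have hv : ‖v‖ ≤ s := by
      rw [Pi.norm_single]
      exact (norm_coe_le_abs s).trans_eq (abs_of_pos hs)
    have h1 : ∑ k ∈ S, s ^ 2 * (16 * ((k i : ℝ) ^ 2 * ‖mFourierCoeff g k‖ ^ 2)) ≤ shiftSq g v := by
      refine (Finset.sum_le_sum fun k hk => ?_).trans
        (sum_le_hasSum S (fun _ _ => by positivity) (hasSum_shiftSq hg v))
      have hki : |(k i : ℝ) * s| ≤ 1 / 2 := by
        have h2 : |(k i : ℝ)| ≤ |N| + 1 := by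
          have h3 := (hN k hk).trans (le_abs_self N)
          have h4 := abs_nonneg (k 0 : ℝ)
          have h5 := abs_nonneg (k 1 : ℝ)
          fin_cases i
          · change |(k 0 : ℝ)| ≤ _; linarith
          · change |(k 1 : ℝ)| ≤ _; linarith
        rw [abs_mul, abs_of_pos hs, hs_def, mul_one_div, div_le_div_iff₀ (by positivity) two_pos]
        linarith
      have := sq_le_norm_mFourier_single_sub_one_sq k i hki
      nlinarith [sq_nonneg ‖mFourierCoeff g k‖]
    -- The shift by `(1/2, 1/2)` has norm `1/2`, so `hK` at this shift rules out a negative `K`.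
    have hK0 : 0 ≤ K := by
      by_contra hneg
      have h5 : 0 ≤ shiftSq g v := integral_nonneg fun _ => by positivity
      have h6 : shiftSq g v ≤ K * ‖v‖ ^ 2 := hK v
      have h7 : shiftSq g (fun _ => ((1 / 2 : ℝ) : UnitAddCircle)) ≤
        K * ‖(fun _ => ((1 / 2 : ℝ) : UnitAddCircle) : Torus)‖ ^ 2 := hK _
      have h8 : 0 ≤ shiftSq g (fun _ => ((1 / 2 : ℝ) : UnitAddCircle)) :=
        integral_nonneg fun _ => by positivity
      have h9 : ‖(fun _ => ((1 / 2 : ℝ) : UnitAddCircle) : Torus)‖ = 1 / 2 := by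
        rw [pi_norm_const, (AddCircle.norm_coe_eq_abs_iff (p := 1) one_ne_zero).2] <;> norm_num
      rw [h9] at h7
      nlinarith
    rw [← Finset.mul_sum] at h1
    have h2 := h1.trans (hK v)
    have h3 : K * ‖v‖ ^ 2 ≤ K * s ^ 2 := by gcongr
    have h4 : 0 < s ^ 2 := by positivity
    nlinarith
  have h0 := key 0
  have h1 := key 1
  rw [← Finset.mul_sum] at h0 h1
  have e : ∑ k ∈ S, ‖waveVec k‖ ^ 2 * ‖mFourierCoeff g k‖ ^ 2 =
      ∑ k ∈ S, (k 0 : ℝ) ^ 2 * ‖mFourierCoeff g k‖ ^ 2 +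
      ∑ k ∈ S, (k 1 : ℝ) ^ 2 * ‖mFourierCoeff g k‖ ^ 2 := by
    rw [← Finset.sum_add_distrib]
    exact Finset.sum_congr rfl fun k _ => by rw [norm_waveVec_sq]; ring
  have p0 : 0 ≤ ∑ k ∈ S, (k 0 : ℝ) ^ 2 * ‖mFourierCoeff g k‖ ^ 2 :=
    Finset.sum_nonneg fun _ _ => by positivity
  have p1 : 0 ≤ ∑ k ∈ S, (k 1 : ℝ) ^ 2 * ‖mFourierCoeff g k‖ ^ 2 :=
    Finset.sum_nonneg fun _ _ => by positivity
  rw [e]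
  linarith

/-! ### Energy over close pairs and composition with a Lipschitz map -/

open Metric
open scoped ENNReal

theorem ofReal_l2NormSq {u : Torus → ℂ} (hu : Continuous u) :
    ENNReal.ofReal (l2NormSq u) = ∫⁻ x, ‖u x‖ₑ ^ 2 ∂torusMeasure := by
  rw [l2NormSq, ofReal_integral_eq_lintegral_ofReal (integrable_of_continuous (by fun_prop))
    (Filter.Eventually.of_forall fun _ => by positivity)]
  congr 1; ext x
  rw [ENNReal.ofReal_pow (norm_nonneg _), ofReal_norm]

theorem ofReal_shiftSq {g : Torus → ℂ} (hg : Continuous g) (h : Torus) :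
    ENNReal.ofReal (shiftSq g h) = ∫⁻ x, ‖g (x + h) - g x‖ₑ ^ 2 ∂torusMeasure :=
  ofReal_l2NormSq (by fun_prop)

theorem haarAddCircle_closedBall (r : ℝ) :
    (AddCircle.haarAddCircle (T := 1)) (closedBall 0 r) = ENNReal.ofReal (min 1 (2 * r)) := by
  have h := AddCircle.volume_closedBall (T := 1) (x := 0) r
  rwa [AddCircle.volume_eq_smul_haarAddCircle, ENNReal.ofReal_one, one_smul] at h

theorem torusMeasure_closedBall {r : ℝ} (hr : 0 ≤ r) :
    torusMeasure (closedBall 0 r) = ENNReal.ofReal (min 1 (2 * r) ^ 2) := by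
  rw [closedBall_pi _ hr, torusMeasure, Measure.pi_pi]
  simp only [Pi.zero_apply, haarAddCircle_closedBall, Finset.prod_const, Finset.card_univ,
    Fintype.card_fin]
  rw [ENNReal.ofReal_pow (by positivity)]

/-- Volume doubling: in the sup norm a ball is a product of arcs, each of measure `min 1 (2r)`. -/
theorem torusMeasure_closedBall_mul_le {r c : ℝ} (hr : 0 ≤ r) (hc : 1 ≤ c) :
    torusMeasure (closedBall 0 (c * r)) ≤ ENNReal.ofReal (c ^ 2) * torusMeasure (closedBall 0 r) := by
  rw [torusMeasure_closedBall hr, torusMeasure_closedBall (by positivity),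
    ← ENNReal.ofReal_mul (by positivity), ← mul_pow]
  refine ENNReal.ofReal_le_ofReal ?_
  gcongr
  rw [mul_min_of_nonneg _ _ (by positivity)]
  exact min_le_min (by linarith) (by linarith)

/-- The energy of `g` at scale `R`. -/
noncomputable def pairEnergy (g : Torus → ℂ) (R : ℝ) : ℝ≥0∞ :=
  ∫⁻ x, ∫⁻ y, (closedBall 0 R).indicator 1 (y - x) * ‖g y - g x‖ₑ ^ 2 ∂torusMeasure ∂torusMeasure

/-- Tonelli and the substitution `y = x + h`. The right side refers only to pairs of points, not to
translations, and so behaves well under changes of variable. -/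
theorem setLIntegral_shiftSq {g : Torus → ℂ} (hg : Continuous g) (R : ℝ) :
    ∫⁻ h in closedBall 0 R, ENNReal.ofReal (shiftSq g h) ∂torusMeasure = pairEnergy g R := by
  have hm : Measurable ((closedBall (0 : Torus) R).indicator (1 : Torus → ℝ≥0∞)) :=
    measurable_one.indicator measurableSet_closedBall
  rw [← lintegral_indicator measurableSet_closedBall]
  have e : ∀ h, (closedBall 0 R).indicator (fun h => ENNReal.ofReal (shiftSq g h)) h =
      ∫⁻ x, (closedBall 0 R).indicator 1 h * ‖g (x + h) - g x‖ₑ ^ 2 ∂torusMeasure := by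
    intro h
    rw [lintegral_const_mul _ (Measurable.pow_const (by fun_prop) 2), ← ofReal_shiftSq hg]
    by_cases hh : h ∈ closedBall (0 : Torus) R <;> simp [hh]
  simp only [e]
  rw [lintegral_lintegral_swap]
  · refine lintegral_congr fun x => ?_
    rw [← lintegral_add_left_eq_self (fun y => (closedBall 0 R).indicator 1 (y - x) *
      ‖g y - g x‖ₑ ^ 2) x]
    simp only [add_sub_cancel_left]
  · refine Measurable.aemeasurable ?_
    have h1 : Continuous fun p : Torus × Torus => g (p.2 + p.1) - g p.2 := by fun_prop
    exact (hm.comp measurable_fst).mul (h1.enorm.measurable.pow_const 2)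

theorem pairEnergy_le {g : Torus → ℂ} (hg : Continuous g) {K R : ℝ}
    (hK : ∀ h, shiftSq g h ≤ K * ‖h‖ ^ 2) (hK0 : 0 ≤ K) :
    pairEnergy g R ≤ ENNReal.ofReal (K * R ^ 2) * torusMeasure (closedBall 0 R) := by
  rw [← setLIntegral_shiftSq hg, ← setLIntegral_const]
  refine setLIntegral_mono' measurableSet_closedBall fun h hh => ENNReal.ofReal_le_ofReal ?_
  refine (hK h).trans ?_
  gcongr
  simpa using hh

/-- Substituting `f x`, `f y` for both variables costs nothing, as `f` preserves the measure; images
within `R` of each other come from points within `L * R`. -/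
theorem pairEnergy_comp_symm_le (f : Torus ≃ Torus)
    (hf : MeasurePreserving f torusMeasure torusMeasure) {L : ℝ}
    (hexp : ∀ x y, ‖x - y‖ ≤ L * ‖f x - f y‖) (hL : 0 ≤ L) (hc : Continuous f.symm)
    {g : Torus → ℂ} (hg : Continuous g) (R : ℝ) :
    pairEnergy (fun x => g (f.symm x)) R ≤ pairEnergy g (L * R) := by
  have hm : Measurable ((closedBall (0 : Torus) R).indicator (1 : Torus → ℝ≥0∞)) :=
    measurable_one.indicator measurableSet_closedBall
  set H : Torus × Torus → ℝ≥0∞ := fun p => (closedBall (0 : Torus) R).indicator 1 (p.2 - p.1) *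
    ‖g (f.symm p.2) - g (f.symm p.1)‖ₑ ^ 2 with hH
  have hM : Measurable H := by
    have h1 : Continuous fun p : Torus × Torus => g (f.symm p.2) - g (f.symm p.1) := by fun_prop
    exact (hm.comp (measurable_snd.sub measurable_fst)).mul (h1.enorm.measurable.pow_const 2)
  have h1 : pairEnergy (fun x => g (f.symm x)) R =
      ∫⁻ x, ∫⁻ y, H (f x, f y) ∂torusMeasure ∂torusMeasure := by
    have h2 := hf.lintegral_comp (hM.lintegral_prod_right' (ν := torusMeasure))
    have h3 : ∀ x, ∫⁻ y, H (x, f y) ∂torusMeasure = ∫⁻ y, H (x, y) ∂torusMeasure := fun x =>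
      hf.lintegral_comp (f := fun y => H (x, y)) (hM.comp (measurable_const.prodMk measurable_id))
    simp only [h3]
    exact h2.symm
  rw [h1, pairEnergy]
  refine lintegral_mono fun x => lintegral_mono fun y => ?_
  simp only [hH, Equiv.symm_apply_apply]
  refine mul_le_mul_left ?_ _
  by_cases h : f y - f x ∈ closedBall (0 : Torus) R
  · have h' : y - x ∈ closedBall (0 : Torus) (L * R) := by
      rw [mem_closedBall_zero_iff] at h ⊢
      exact (hexp y x).trans (mul_le_mul_of_nonneg_left h hL)
    rw [Set.indicator_of_mem h, Set.indicator_of_mem h']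
    rfl
  · rw [Set.indicator_of_notMem h]
    exact zero_le

theorem l2NormSq_translate (u : Torus → ℂ) (h : Torus) :
    l2NormSq (fun x => u (x + h)) = l2NormSq u :=
  integral_add_right_eq_self (μ := torusMeasure) (fun x => ‖u x‖ ^ 2) h

theorem l2NormSq_sub_le {u v : Torus → ℂ} (hu : Continuous u) (hv : Continuous v) :
    l2NormSq (fun x => u x - v x) ≤ 2 * l2NormSq u + 2 * l2NormSq v := by
  unfold l2NormSq
  rw [← integral_const_mul, ← integral_const_mul, ← integral_add
    (integrable_of_continuous (by fun_prop)) (integrable_of_continuous (by fun_prop))]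
  refine integral_mono (integrable_of_continuous (by fun_prop))
    (integrable_of_continuous (by fun_prop)) fun x => ?_
  have := norm_sub_le (u x) (v x)
  simp only
  nlinarith [norm_nonneg (u x - v x), sq_nonneg (‖u x‖ - ‖v x‖)]

theorem shiftSq_le_of_add {g : Torus → ℂ} (hg : Continuous g) (h v : Torus) :
    shiftSq g v ≤ 2 * shiftSq g (h + v) + 2 * shiftSq g h := by
  have e : shiftSq g v = l2NormSq fun x => (g (x + (h + v)) - g x) - (g (x + h) - g x) := by
    rw [shiftSq, ← l2NormSq_translate _ h]
    congr 1; ext x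
    rw [sub_sub_sub_cancel_right, add_assoc]
  rw [e]
  exact l2NormSq_sub_le (by fun_prop) (by fun_prop)

theorem shiftSq_nonneg (g : Torus → ℂ) (h : Torus) : 0 ≤ shiftSq g h :=
  integral_nonneg fun _ => by positivity

theorem measurable_shiftSq {g : Torus → ℂ} (hg : Continuous g) :
    Measurable fun h => ENNReal.ofReal (shiftSq g h) := by
  simp only [ofReal_shiftSq hg]
  refine Measurable.lintegral_prod_right' (f := fun p : Torus × Torus =>
    ‖g (p.2 + p.1) - g p.2‖ₑ ^ 2) ?_
  have h1 : Continuous fun p : Torus × Torus => g (p.2 + p.1) - g p.2 := by fun_prop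
  exact h1.enorm.measurable.pow_const 2

/-- Averaging over a ball controls a single shift by the energy at a comparable scale. -/
theorem mul_shiftSq_le_pairEnergy {g : Torus → ℂ} (hg : Continuous g) (v : Torus) :
    torusMeasure (closedBall 0 ‖v‖) * ENNReal.ofReal (shiftSq g v) ≤
      4 * pairEnergy g (2 * ‖v‖) := by
  have hm := measurable_shiftSq hg
  -- The shift by `v` is the shift by `h + v` undone by `h`; for `‖h‖ ≤ ‖v‖` both lie in the ball of
  -- radius `2‖v‖`, and `h` is averaged out.
  have h1 : ∀ h, ENNReal.ofReal (shiftSq g v) ≤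
      2 * ENNReal.ofReal (shiftSq g (h + v)) + 2 * ENNReal.ofReal (shiftSq g h) := by
    intro h
    have := ENNReal.ofReal_le_ofReal (shiftSq_le_of_add hg h v)
    rwa [ENNReal.ofReal_add (by have := shiftSq_nonneg g (h + v); positivity)
      (by have := shiftSq_nonneg g h; positivity), ENNReal.ofReal_mul zero_le_two,
      ENNReal.ofReal_mul zero_le_two, ENNReal.ofReal_ofNat] at this
  have h2 : ∫⁻ h in closedBall 0 ‖v‖, ENNReal.ofReal (shiftSq g h) ∂torusMeasure ≤
      pairEnergy g (2 * ‖v‖) := by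
    rw [← setLIntegral_shiftSq hg]
    refine lintegral_mono_set (closedBall_subset_closedBall ?_)
    linarith [norm_nonneg v]
  have h3 : ∫⁻ h in closedBall 0 ‖v‖, ENNReal.ofReal (shiftSq g (h + v)) ∂torusMeasure ≤
      pairEnergy g (2 * ‖v‖) := by
    rw [← setLIntegral_shiftSq hg, ← lintegral_indicator measurableSet_closedBall,
      ← lintegral_indicator measurableSet_closedBall,
      ← lintegral_add_right_eq_self ((closedBall 0 (2 * ‖v‖)).indicator _) v]
    refine lintegral_mono fun h => ?_
    by_cases hh : h ∈ closedBall (0 : Torus) ‖v‖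
    · have hh' : h + v ∈ closedBall (0 : Torus) (2 * ‖v‖) := by
        rw [mem_closedBall_zero_iff] at hh ⊢
        linarith [norm_add_le h v]
      rw [Set.indicator_of_mem hh, Set.indicator_of_mem hh']
    · simp [Set.indicator_of_notMem hh]
  calc torusMeasure (closedBall 0 ‖v‖) * ENNReal.ofReal (shiftSq g v)
      = ∫⁻ _ in closedBall (0 : Torus) ‖v‖, ENNReal.ofReal (shiftSq g v) ∂torusMeasure := by
        rw [setLIntegral_const, mul_comm]
    _ ≤ ∫⁻ h in closedBall (0 : Torus) ‖v‖, (2 * ENNReal.ofReal (shiftSq g (h + v)) +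
          2 * ENNReal.ofReal (shiftSq g h)) ∂torusMeasure := lintegral_mono fun h => h1 h
    _ = 2 * ∫⁻ h in closedBall 0 ‖v‖, ENNReal.ofReal (shiftSq g (h + v)) ∂torusMeasure +
          2 * ∫⁻ h in closedBall 0 ‖v‖, ENNReal.ofReal (shiftSq g h) ∂torusMeasure := by
        rw [lintegral_add_right _ (hm.const_mul 2), lintegral_const_mul _ hm,
          lintegral_const_mul 2 (f := fun h => ENNReal.ofReal (shiftSq g (h + v)))
            (hm.comp (measurable_add_const v))]
    _ ≤ 2 * pairEnergy g (2 * ‖v‖) + 2 * pairEnergy g (2 * ‖v‖) := by gcongr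
    _ = _ := by rw [← add_mul]; norm_num

/-- Composition with an `L`-Lipschitz measure-preserving map keeps the `L²` modulus of
continuity, up to a constant factor. -/
theorem shiftSq_comp_symm_le (f : Torus ≃ Torus)
    (hf : MeasurePreserving f torusMeasure torusMeasure) {L : ℝ}
    (hexp : ∀ x y, ‖x - y‖ ≤ L * ‖f x - f y‖) (hL : 1 ≤ L) (hc : Continuous f.symm)
    {g : Torus → ℂ} (hg : Continuous g) {K : ℝ} (hK0 : 0 ≤ K)
    (hK : ∀ h, shiftSq g h ≤ K * ‖h‖ ^ 2) (v : Torus) :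
    shiftSq (fun x => g (f.symm x)) v ≤ 64 * L ^ 4 * K * ‖v‖ ^ 2 := by
  -- A zero shift is separated because the final division needs a ball of positive measure.
  by_cases hv : v = 0
  · subst hv; simp [shiftSq, l2NormSq]
  have hv0 : 0 < ‖v‖ := norm_pos_iff.2 hv
  have hpos : torusMeasure (closedBall 0 ‖v‖) ≠ 0 := by
    rw [torusMeasure_closedBall hv0.le]
    have : 0 < min 1 (2 * ‖v‖) ^ 2 := by positivity
    exact (ENNReal.ofReal_pos.2 this).ne'
  have hfin : torusMeasure (closedBall 0 ‖v‖) ≠ ⊤ := measure_ne_top _ _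
  have h1 := mul_shiftSq_le_pairEnergy (hg.comp hc) v
  have h2 := pairEnergy_comp_symm_le f hf hexp (by linarith) hc hg (2 * ‖v‖)
  have h3 := pairEnergy_le hg (R := L * (2 * ‖v‖)) hK hK0
  have h4 := torusMeasure_closedBall_mul_le hv0.le (c := 2 * L) (by linarith)
  have e : L * (2 * ‖v‖) = 2 * L * ‖v‖ := by ring
  rw [e] at h2 h3
  have h5 : torusMeasure (closedBall 0 ‖v‖) * ENNReal.ofReal (shiftSq (g ∘ f.symm) v) ≤
      torusMeasure (closedBall 0 ‖v‖) * ENNReal.ofReal (64 * L ^ 4 * K * ‖v‖ ^ 2) := by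
    -- The factor `64 L⁴` is 4 from averaging, `(2L)²` from the squared radius and `(2L)²` from
    -- volume doubling.
    calc _ ≤ 4 * (ENNReal.ofReal (K * (2 * L * ‖v‖) ^ 2) *
          (ENNReal.ofReal ((2 * L) ^ 2) * torusMeasure (closedBall 0 ‖v‖))) :=
          h1.trans (by gcongr; exact h2.trans (h3.trans (by gcongr)))
      _ = torusMeasure (closedBall 0 ‖v‖) *
          (ENNReal.ofReal 4 * (ENNReal.ofReal (K * (2 * L * ‖v‖) ^ 2) *
            ENNReal.ofReal ((2 * L) ^ 2))) := by
          rw [ENNReal.ofReal_ofNat]; ring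
      _ = _ := by
          rw [← ENNReal.ofReal_mul (by positivity), ← ENNReal.ofReal_mul (by positivity)]
          ring_nf
  rw [ENNReal.mul_le_mul_iff_right hpos hfin, ENNReal.ofReal_le_ofReal_iff (by positivity)] at h5
  exact h5

/-! ### Lifting points to the plane -/

theorem cover_sub (x y : Plane) : cover (x - y) = cover x - cover y := by
  ext i; simp [cover]

theorem norm_cover_le (x : Plane) : ‖cover x‖ ≤ ‖x‖ :=
  (pi_norm_le_iff_of_nonneg (norm_nonneg x)).2 fun i =>
    (norm_coe_le_abs (x i)).trans (PiLp.norm_apply_le x i)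

theorem exists_cover_eq (v : Torus) : ∃ x : Plane, cover x = v ∧ ‖x‖ ≤ 2 * ‖v‖ := by
  choose t ht htn using fun i => exists_coe_eq_abs_eq_norm (v i)
  refine ⟨WithLp.toLp 2 t, funext ht, ?_⟩
  refine le_of_sq_le_sq ?_ (by positivity)
  rw [EuclideanSpace.norm_sq_eq, Fin.sum_univ_two]
  have h : ∀ i, ‖t i‖ ≤ ‖v‖ := fun i => (htn i).trans_le (norm_le_pi_norm v i)
  have h0 := mul_self_le_mul_self (norm_nonneg _) (h 0)
  have h1 := mul_self_le_mul_self (norm_nonneg _) (h 1)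
  simp only
  nlinarith [norm_nonneg v]

theorem exists_cover_eq_cover_eq (x y : Torus) :
    ∃ a b : Plane, cover a = x ∧ cover b = y ∧ ‖a - b‖ ≤ 2 * ‖x - y‖ := by
  obtain ⟨d, hd, hdn⟩ := exists_cover_eq (x - y)
  obtain ⟨b, hb, -⟩ := exists_cover_eq y
  refine ⟨b + d, b, ?_, hb, by simpa using hdn⟩
  have := cover_sub (b + d) b
  rw [add_sub_cancel_left, hd, hb] at this
  exact (sub_left_injective this).symm

/-! ### The distances -/

theorem c0Dist_nonneg (f g : Torus → Torus) : 0 ≤ c0Dist f g :=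
  Real.iSup_nonneg fun _ => Real.sqrt_nonneg _

theorem cDist_mono (f g : Torus → Torus) : Monotone (cDist f g) :=
  monotone_nat_of_le_succ fun _ => le_max_left _ _

theorem cDist_nonneg (f g : Torus → Torus) (k : ℕ) : 0 ≤ cDist f g k :=
  (c0Dist_nonneg f g).trans (cDist_mono f g k.zero_le)

/-- The `k = 1` term alone gives `d / (1 + d) ≤ 2ε`, which inverts to `d ≤ 4ε` when `ε ≤ 1/4`. -/
theorem cDist_one_le {f g : Torus → Torus} {ε : ℝ} (hε : ε ≤ 1 / 4) (h : cInftyDist f g ≤ ε) :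
    cDist f g 1 ≤ 4 * ε := by
  have hd := cDist_nonneg f g
  have hterm : ∀ k, 0 ≤ (1 / 2 : ℝ) ^ k * (cDist f g k / (1 + cDist f g k)) := fun k => by
    have := hd k; positivity
  -- Without summability the series would take the default value 0 and control nothing.
  have hs : Summable fun k : ℕ => (1 / 2 : ℝ) ^ k * (cDist f g k / (1 + cDist f g k)) := by
    refine Summable.of_nonneg_of_le hterm (fun k => ?_) summable_geometric_two
    refine mul_le_of_le_one_right (by positivity) ?_
    have := hd k
    rw [div_le_one (by positivity)]; linarith
  have h1 : (1 / 2 : ℝ) ^ 1 * (cDist f g 1 / (1 + cDist f g 1)) ≤ ε :=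
    (hs.le_tsum 1 fun j _ => hterm j).trans h
  have h2 := hd 1
  have h3 : cDist f g 1 ≤ 2 * ε * (1 + cDist f g 1) := by
    rw [← div_le_iff₀ (by positivity)]; linarith
  nlinarith

theorem norm_sub_le_c0Dist (f g : Torus → Torus) (x : Torus) : ‖f x - g x‖ ≤ c0Dist f g := by
  -- The supremum of an unbounded set of reals defaults to 0, so boundedness is needed to bound each
  -- value by it.
  have hb : BddAbove (Set.range fun x => √(∑ i, ‖f x i - g x i‖ ^ 2)) := by
    refine ⟨√(∑ _i : Fin 2, (1 / 2) ^ 2), ?_⟩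
    rintro _ ⟨y, rfl⟩
    refine Real.sqrt_le_sqrt (Finset.sum_le_sum fun i _ => ?_)
    have := AddCircle.norm_le_half_period (p := (1 : ℝ)) (x := f y i - g y i) one_ne_zero
    rw [abs_one] at this
    gcongr
  refine le_trans ?_ (le_ciSup hb x)
  refine (pi_norm_le_iff_of_nonneg (Real.sqrt_nonneg _)).2 fun i => ?_
  refine Real.le_sqrt_of_sq_le ?_
  exact Finset.single_le_sum (f := fun i => ‖f x i - g x i‖ ^ 2) (fun _ _ => by positivity)
    (Finset.mem_univ i)

theorem cover_add_waveVec (x : Plane) (m : Wave) : cover (x + waveVec m) = cover x := by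
  ext i
  simp only [cover, waveVec, PiLp.add_apply, AddCircle.coe_add, add_eq_left]
  exact (AddCircle.coe_eq_zero_iff (1 : ℝ)).2 ⟨m i, by simp⟩

theorem torusDeriv_one_periodic {f : Torus → Torus} (hf : IsSmooth f) (x : Plane) (m : Wave) :
    torusDeriv 1 f (x + waveVec m) = torusDeriv 1 f x := by
  have h := isSmoothLift_lift hf
  have h' : IsSmoothLift (fun y => lift f (y + waveVec m)) f :=
    ⟨h.1.comp (contDiff_id.add contDiff_const), fun y => by rw [h.2, cover_add_waveVec]⟩
  have := iteratedFDeriv_eq_of_isSmoothLift h' h 0 x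
  rwa [iteratedFDeriv_comp_add_right] at this

theorem continuous_torusDeriv_one {f : Torus → Torus} (hf : IsSmooth f) :
    Continuous (torusDeriv 1 f) :=
  (isSmoothLift_lift hf).1.continuous_iteratedFDeriv (by exact_mod_cast le_top)

theorem bddAbove_of_periodic {u : Plane → ℝ} (hu : Continuous u)
    (hp : ∀ x m, u (x + waveVec m) = u x) : BddAbove (Set.range u) := by
  obtain ⟨C, hC⟩ := (isCompact_closedBall (0 : Plane) 2).bddAbove_image hu.continuousOn
  refine ⟨C, ?_⟩
  rintro _ ⟨x, rfl⟩
  -- Translation by `m` moves `x` into the unit square, inside the ball of radius 2.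
  set m : Wave := fun i => -⌊x i⌋
  rw [← hp x m]
  refine hC (Set.mem_image_of_mem u ?_)
  rw [mem_closedBall_zero_iff]
  refine le_of_sq_le_sq ?_ zero_le_two
  have h : ∀ i, (x + waveVec m) i = Int.fract (x i) := fun i => by
    simp [waveVec, m, Int.fract, sub_eq_add_neg]
  rw [EuclideanSpace.norm_sq_eq, Fin.sum_univ_two, h, h, Real.norm_eq_abs, Real.norm_eq_abs,
    Int.abs_fract, Int.abs_fract]
  nlinarith [Int.fract_nonneg (x 0), Int.fract_lt_one (x 0), Int.fract_nonneg (x 1),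
    Int.fract_lt_one (x 1)]

theorem norm_torusDeriv_sub_le {f g : Torus → Torus} (hf : IsSmooth f) (hg : IsSmooth g)
    (x : Plane) : ‖torusDeriv 1 f x - torusDeriv 1 g x‖ ≤ cDist f g 1 := by
  refine le_trans ?_ (le_max_right _ _)
  refine le_ciSup (f := fun x => ‖torusDeriv (0 + 1) f x - torusDeriv (0 + 1) g x‖)
    (bddAbove_of_periodic ?_ ?_) x
  · exact ((continuous_torusDeriv_one hf).sub (continuous_torusDeriv_one hg)).norm
  · intro y m
    simp only [torusDeriv_one_periodic hf, torusDeriv_one_periodic hg]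

/-- The difference of two smooth maps of the torus is Lipschitz with a constant controlled by their
`C¹` distance. -/
theorem norm_sub_sub_sub_le {f g : Torus → Torus} (hf : IsSmooth f) (hg : IsSmooth g)
    (x y : Torus) :
    ‖(f x - g x) - (f y - g y)‖ ≤ 2 * cDist f g 1 * ‖x - y‖ := by
  have hF := isSmoothLift_lift hf
  have hG := isSmoothLift_lift hg
  obtain ⟨a, b, rfl, rfl, hab⟩ := exists_cover_eq_cover_eq x y
  have hdF : Differentiable ℝ (lift f) := hF.1.differentiable (by simp)
  have hdG : Differentiable ℝ (lift g) := hG.1.differentiable (by simp)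
  have hder : ∀ z, ‖fderiv ℝ (fun z => lift f z - lift g z) z‖ ≤ cDist f g 1 := by
    intro z
    refine le_trans (le_of_eq ?_) (norm_torusDeriv_sub_le hf hg z)
    rw [← norm_iteratedFDeriv_one]
    congr 1
    have := iteratedFDeriv_sub_apply (𝕜 := ℝ) (i := 1) (x := z) (f := lift f) (g := lift g)
      (hF.1.contDiffAt.of_le (by exact_mod_cast le_top))
      (hG.1.contDiffAt.of_le (by exact_mod_cast le_top))
    exact this
  have hL : ‖(lift f a - lift g a) - (lift f b - lift g b)‖ ≤ cDist f g 1 * ‖a - b‖ :=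
    Convex.norm_image_sub_le_of_norm_fderiv_le (𝕜 := ℝ) (f := fun z => lift f z - lift g z)
      (fun z _ => (hdF z).sub (hdG z)) (fun z _ => hder z) convex_univ (Set.mem_univ b)
      (Set.mem_univ a)
  rw [← hF.2, ← hG.2, ← hF.2, ← hG.2, ← cover_sub, ← cover_sub, ← cover_sub]
  refine (norm_cover_le _).trans (hL.trans ?_)
  nlinarith [cDist_nonneg f g 1]

/-! ### CAT maps -/

theorem catMap_cover (A : Matrix (Fin 2) (Fin 2) ℤ) (x : Plane) :
    catMap A (cover x) = cover (WithLp.toLp 2 fun i => ∑ j, (A i j : ℝ) * x j) := by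
  ext i
  simp only [catMap, cover, Fin.sum_univ_two, AddCircle.coe_add, ← zsmul_eq_mul, AddCircle.coe_zsmul]

theorem isSmooth_catMap (A : Matrix (Fin 2) (Fin 2) ℤ) : IsSmooth (catMap A) := by
  refine ⟨fun x => WithLp.toLp 2 fun i => ∑ j, (A i j : ℝ) * x j, ?_, fun x =>
    (catMap_cover A x).symm⟩
  rw [contDiff_piLp]
  intro i
  simp only
  exact ContDiff.sum fun j _ => contDiff_const.mul (contDiff_piLp_apply 2)

theorem catMap_sub (A : Matrix (Fin 2) (Fin 2) ℤ) (x y : Torus) :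
    catMap A (x - y) = catMap A x - catMap A y := by
  ext i
  simp [catMap, smul_sub, Finset.sum_sub_distrib]

theorem catMap_catMap (A B : Matrix (Fin 2) (Fin 2) ℤ) (x : Torus) :
    catMap A (catMap B x) = catMap (A * B) x := by
  ext i
  simp only [catMap, Fin.sum_univ_two, Matrix.mul_apply, smul_add, add_smul, smul_smul]
  abel

theorem catMap_one (x : Torus) : catMap 1 x = x := by
  ext i
  simp [catMap, Matrix.one_apply]

theorem norm_catMap_le (A : Matrix (Fin 2) (Fin 2) ℤ) (x : Torus) :
    ‖catMap A x‖ ≤ (∑ i, ∑ j, |(A i j : ℝ)|) * ‖x‖ := by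
  refine (pi_norm_le_iff_of_nonneg (by positivity)).2 fun i => ?_
  calc ‖∑ j, A i j • x j‖ ≤ ∑ j, |(A i j : ℝ)| * ‖x‖ := by
        refine norm_sum_le_of_le _ fun j _ => ?_
        refine (norm_zsmul_le _ _).trans ?_
        rw [Int.norm_eq_abs]
        gcongr
        exact norm_le_pi_norm x j
    _ = (∑ j, |(A i j : ℝ)|) * ‖x‖ := by rw [Finset.sum_mul]
    _ ≤ _ := by
        refine mul_le_mul_of_nonneg_right ?_ (norm_nonneg x)
        exact Finset.single_le_sum (f := fun i => ∑ j, |(A i j : ℝ)|)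
          (fun i _ => Finset.sum_nonneg fun j _ => abs_nonneg (A i j : ℝ)) (Finset.mem_univ i)

theorem mFourier_catMap (A : Matrix (Fin 2) (Fin 2) ℤ) (k : Wave) (x : Torus) :
    mFourier k (catMap A x) = mFourier (A.transpose.mulVec k) x := by
  simp only [mFourier, ContinuousMap.coe_mk, Fin.prod_univ_two, catMap, fourier_apply,
    Fin.sum_univ_two, Matrix.mulVec, dotProduct, Matrix.transpose_apply, smul_add, smul_smul,
    add_smul, AddCircle.toCircle_add, Circle.coe_mul]
  rw [mul_comm (A 0 0), mul_comm (A 1 0), mul_comm (A 0 1), mul_comm (A 1 1)]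
  ring

/-- A small `C¹` perturbation of an invertible CAT map contracts distances at most by a factor. -/
theorem norm_sub_le_of_near_catMap {A B : Matrix (Fin 2) (Fin 2) ℤ} (hBA : B * A = 1) {b : ℝ}
    (hb : ∀ x, ‖catMap B x‖ ≤ b * ‖x‖) (hb0 : 0 ≤ b) {f : Torus → Torus} {δ : ℝ}
    (hδ : ∀ x y, ‖(f x - catMap A x) - (f y - catMap A y)‖ ≤ δ * ‖x - y‖)
    (hbδ : b * δ ≤ 1 / 2) (x y : Torus) : ‖x - y‖ ≤ 2 * b * ‖f x - f y‖ := by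
  -- The torus is a group and `catMap A` a homomorphism, so the inverse function argument works
  -- globally: recover `catMap A (x - y)`, apply `B`, then absorb the term `b * δ * ‖x - y‖`.
  have e : x - y = catMap B ((f x - f y) - ((f x - catMap A x) - (f y - catMap A y))) := by
    have : (f x - f y) - ((f x - catMap A x) - (f y - catMap A y)) = catMap A (x - y) := by
      rw [catMap_sub]; abel
    rw [this, catMap_catMap, hBA, catMap_one]
  have h1 : ‖x - y‖ ≤ b * (‖f x - f y‖ + δ * ‖x - y‖) := by
    calc ‖x - y‖ = _ := congrArg norm e
      _ ≤ b * ‖(f x - f y) - ((f x - catMap A x) - (f y - catMap A y))‖ := hb _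
      _ ≤ _ := by gcongr; exact (norm_sub_le _ _).trans (by gcongr; exact hδ x y)
  nlinarith [norm_nonneg (x - y)]

theorem continuous_symm_of_expansion (f : Torus ≃ Torus) {L : ℝ} (hL : 0 ≤ L)
    (hexp : ∀ x y, ‖x - y‖ ≤ L * ‖f x - f y‖) : Continuous f.symm := by
  refine (LipschitzWith.of_dist_le_mul (K := ⟨L, hL⟩) fun x y => ?_).continuous
  have := hexp (f.symm x) (f.symm y)
  rw [f.apply_symm_apply, f.apply_symm_apply] at this
  rwa [dist_eq_norm, dist_eq_norm]

theorem norm_mFourier_sub_le (k : Wave) (x y : Torus) :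
    ‖mFourier k x - mFourier k y‖ ≤ 2 * Real.pi * (|(k 0 : ℝ)| + |(k 1 : ℝ)|) * ‖x - y‖ := by
  have e : mFourier k x - mFourier k y = mFourier k y * (mFourier k (x - y) - 1) := by
    rw [mul_sub, mul_one, ← mFourier_apply_add, add_sub_cancel]
  rw [e, norm_mul, norm_mFourier_apply, one_mul]
  exact norm_mFourier_sub_one_le k _

theorem shiftSq_le_of_lipschitz {g : Torus → ℂ} {K : ℝ}
    (hg : ∀ x y, ‖g x - g y‖ ≤ K * ‖x - y‖) (h : Torus) : shiftSq g h ≤ K ^ 2 * ‖h‖ ^ 2 := by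
  have h1 : shiftSq g h ≤ ∫ _x : Torus, (K * ‖h‖) ^ 2 ∂torusMeasure := by
    refine integral_mono_of_nonneg (Filter.Eventually.of_forall fun _ => by positivity)
      (integrable_const _) (Filter.Eventually.of_forall fun x => ?_)
    have := hg (x + h) x
    rw [add_sub_cancel_left] at this
    simp only
    gcongr
  simpa [mul_pow] using h1

/-- The effect on a mode of replacing a CAT map by a perturbation of it. -/
theorem gradBound_mode_transfer_sub {A : Matrix (Fin 2) (Fin 2) ℤ} (f : Torus ≃ Torus) {δ L : ℝ}
    (hδ0 : 0 ≤ δ) (hL : 0 ≤ L) (hsup : ∀ x, ‖f x - catMap A x‖ ≤ δ)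
    (hlip : ∀ x y, ‖(f x - catMap A x) - (f y - catMap A y)‖ ≤ δ * ‖x - y‖)
    (hexp : ∀ x y, ‖x - y‖ ≤ L * ‖f x - f y‖) {k k' : Wave}
    (hk : A.transpose.mulVec k' = k) :
    GradBound (fun x => mFourier k (f.symm x) - mFourier k' x)
      (8 * Real.pi ^ 2 * ‖waveVec k'‖ ^ 2 * (16 * Real.pi ^ 2 * ‖waveVec k‖ ^ 2 + 2) *
        δ ^ 2 * L ^ 2) := by
  have hc := continuous_symm_of_expansion f hL hexp
  set N : Wave → ℝ := fun k => 2 * Real.pi * (|(k 0 : ℝ)| + |(k 1 : ℝ)|) with hN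
  have hN0 : ∀ k, 0 ≤ N k := fun k => by simp only [hN]; positivity
  have hN2 : ∀ k, N k ^ 2 ≤ 8 * Real.pi ^ 2 * ‖waveVec k‖ ^ 2 := fun k => by
    have := sq_sum_abs_le k
    simp only [hN, mul_pow]
    nlinarith [sq_nonneg Real.pi]
  -- At the point `f a`, the transferred mode is `mFourier k a` and the target mode differs from it
  -- by a phase depending only on `f - f_A`, which is small and has small Lipschitz constant.
  have e : ∀ a, mFourier k' (f a) = mFourier k a * mFourier k' (f a - catMap A a) := fun a => by
    rw [← hk, ← mFourier_catMap, ← mFourier_apply_add, add_sub_cancel]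
  have key : ∀ a b, ‖(mFourier k a - mFourier k' (f a)) - (mFourier k b - mFourier k' (f b))‖ ≤
      N k' * (N k + 1) * δ * ‖a - b‖ := by
    intro a b
    have h1 := norm_mFourier_sub_one_le k' (f a - catMap A a)
    have h2 := norm_mFourier_sub_le k' (f b - catMap A b) (f a - catMap A a)
    have h3 := norm_mFourier_sub_le k a b
    have h4 : (mFourier k a - mFourier k' (f a)) - (mFourier k b - mFourier k' (f b)) =
        -((mFourier k a - mFourier k b) * (mFourier k' (f a - catMap A a) - 1)) +
        mFourier k b * (mFourier k' (f b - catMap A b) - mFourier k' (f a - catMap A a)) := by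
      rw [e, e]; ring
    rw [h4]
    calc _ ≤ ‖mFourier k a - mFourier k b‖ * ‖mFourier k' (f a - catMap A a) - 1‖ +
          ‖mFourier k' (f b - catMap A b) - mFourier k' (f a - catMap A a)‖ := by
          refine (norm_add_le _ _).trans_eq ?_
          rw [norm_neg, norm_mul, norm_mul, norm_mFourier_apply, one_mul]
      _ ≤ (N k * ‖a - b‖) * (N k' * δ) + N k' * (δ * ‖a - b‖) := by
          have h5 := hN0 k
          have h6 := hN0 k'
          have h7 := (hlip b a).trans_eq (by rw [norm_sub_rev b a])
          exact add_le_add (mul_le_mul h3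
            (h1.trans (mul_le_mul_of_nonneg_left (hsup a) h6)) (norm_nonneg _) (by positivity))
            (h2.trans (mul_le_mul_of_nonneg_left h7 h6))
      _ = _ := by ring
  have key2 : ∀ x y, ‖(mFourier k (f.symm x) - mFourier k' x) -
      (mFourier k (f.symm y) - mFourier k' y)‖ ≤ N k' * (N k + 1) * δ * L * ‖x - y‖ := by
    intro x y
    have h1 := key (f.symm x) (f.symm y)
    have h2 := hexp (f.symm x) (f.symm y)
    rw [f.apply_symm_apply, f.apply_symm_apply] at h1 h2
    have h5 := hN0 k
    have h6 := hN0 k'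
    calc _ ≤ _ := h1
      _ ≤ N k' * (N k + 1) * δ * (L * ‖x - y‖) := by gcongr
      _ = _ := by ring
  refine (gradBound_of_shiftSq_le (by fun_prop) (shiftSq_le_of_lipschitz key2)).mono ?_
  have h7 : (N k + 1) ^ 2 ≤ 16 * Real.pi ^ 2 * ‖waveVec k‖ ^ 2 + 2 := by
    nlinarith [hN2 k, sq_nonneg (N k - 1)]
  rw [mul_pow, mul_pow, mul_pow]
  have := hN2 k'
  gcongr

/-! ### Propagation of the seminorm and of the mass along the pulse -/

theorem GradBound.transfer {f : Torus ≃ Torus}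
    (hf : MeasurePreserving f torusMeasure torusMeasure) {L : ℝ}
    (hexp : ∀ x y, ‖x - y‖ ≤ L * ‖f x - f y‖) (hL : 1 ≤ L)
    {g : Torus → ℂ} (hg : Continuous g) {Q : ℝ} (hQ : GradBound g Q) :
    GradBound (transfer f g) (512 * Real.pi ^ 2 * L ^ 4 * Q) := by
  have hc := continuous_symm_of_expansion f (by linarith) hexp
  have hQ0 := hQ.nonneg
  refine (gradBound_of_shiftSq_le (hg.comp hc) (shiftSq_comp_symm_le f hf hexp hL hc hg
    (K := 8 * Real.pi ^ 2 * Q) (by positivity) (hQ.shiftSq_le hg))).mono (le_of_eq (by ring))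

theorem norm_mFourierCoeff_heat_le {κ : ℝ} (hκ : 0 < κ) (g : Torus → ℂ) (k : Wave) :
    ‖mFourierCoeff (heat κ g) k‖ ≤ ‖mFourierCoeff g k‖ := by
  rw [mFourierCoeff_heat hκ, norm_mul, Complex.norm_real, Real.norm_of_nonneg (damp_pos κ k).le]
  exact mul_le_of_le_one_left (norm_nonneg _) (damp_le_one hκ.le k)

theorem l2NormSq_transfer {f : Torus ≃ Torus} (hf : MeasurePreserving f torusMeasure torusMeasure)
    (hc : Continuous f.symm) {g : Torus → ℂ} (hg : Continuous g) :
    l2NormSq (transfer f g) = l2NormSq g := by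
  have hm : AEStronglyMeasurable (fun x => ‖g (f.symm x)‖ ^ 2)
      (Measure.map f torusMeasure) := Continuous.aestronglyMeasurable (by fun_prop)
  have h := integral_map hf.measurable.aemeasurable hm
  rw [hf.map_eq] at h
  simpa [l2NormSq, PulseCat.transfer] using h

theorem mFourierCoeff_transfer_zero {f : Torus ≃ Torus}
    (hf : MeasurePreserving f torusMeasure torusMeasure)
    (hc : Continuous f.symm) {g : Torus → ℂ} (hg : Continuous g) :
    mFourierCoeff (transfer f g) 0 = mFourierCoeff g 0 := by
  have hm : AEStronglyMeasurable (fun x => g (f.symm x))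
      (Measure.map f torusMeasure) := Continuous.aestronglyMeasurable (by fun_prop)
  have h := integral_map hf.measurable.aemeasurable hm
  rw [hf.map_eq] at h
  rw [mFourierCoeff_zero_eq_integral, mFourierCoeff_zero_eq_integral]
  simpa [PulseCat.transfer] using h

/-- The heat flow loses little energy at moderate frequencies. -/
theorem l2NormSq_heat_ge {κ : ℝ} (hκ : 0 < κ) {g : Torus → ℂ} (hg : Continuous g) {Q : ℝ}
    (hQ : GradBound g Q) :
    l2NormSq g - 8 * Real.pi ^ 2 * κ * Q ≤ l2NormSq (heat κ g) := by
  have h1 := hasSum_sq_mFourierCoeff_of_continuous hg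
  have h2 := hasSum_sq_mFourierCoeff_of_continuous (continuous_heat hκ g)
  have h3 := h1.sub (hQ.summable.hasSum.mul_left (8 * Real.pi ^ 2 * κ))
  have h4 := hasSum_le (fun k => ?_) h3 h2
  · refine le_trans ?_ h4
    have := hQ.tsum_le
    gcongr
  · rw [mFourierCoeff_heat hκ, norm_mul, Complex.norm_real, mul_pow, Real.norm_eq_abs, sq_abs]
    -- This is `exp (-2t) ≥ 1 - 2t`.
    have h5 : 1 - 8 * Real.pi ^ 2 * κ * ‖waveVec k‖ ^ 2 ≤ damp κ k ^ 2 := by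
      rw [damp, ← Real.exp_nat_mul]
      have := Real.add_one_le_exp (((2 : ℕ) : ℝ) * -(4 * Real.pi ^ 2 * ‖waveVec k‖ ^ 2 * κ))
      push_cast at this ⊢
      linarith
    nlinarith [sq_nonneg ‖mFourierCoeff g k‖]

theorem pulse_succ (f : Torus ≃ Torus) (κ : ℝ) (k₀ : Wave) (n : ℕ) :
    pulse f κ k₀ (n + 1) = heat κ (transfer f (pulse f κ k₀ n)) := by
  rw [pulse, Function.iterate_succ_apply']; rfl

theorem continuous_pulse (f : Torus ≃ Torus) {κ : ℝ} (hκ : 0 < κ) (k₀ : Wave) (n : ℕ) :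
    Continuous (pulse f κ k₀ n) := by
  cases n with
  | zero => exact (mFourier k₀).continuous
  | succ n => rw [pulse_succ]; exact continuous_heat hκ _

theorem gradBound_mFourier (k₀ : Wave) :
    GradBound (fun x => mFourier k₀ x) (‖waveVec k₀‖ ^ 2) := fun S => by
  have : ∀ k ∈ S, ‖waveVec k‖ ^ 2 * ‖mFourierCoeff (fun x => mFourier k₀ x) k‖ ^ 2 =
      if k = k₀ then ‖waveVec k₀‖ ^ 2 else 0 := fun k _ => by
    rw [mFourierCoeff_mFourier]; split_ifs with h <;> simp [h]
  rw [Finset.sum_congr rfl this, Finset.sum_ite_eq']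
  split_ifs
  exacts [le_rfl, by positivity]

theorem l2NormSq_mFourier (k₀ : Wave) : l2NormSq (fun x => mFourier k₀ x) = 1 := by
  simp [l2NormSq, norm_mFourier_apply]

theorem gradBound_pulse {f : Torus ≃ Torus} (hf : MeasurePreserving f torusMeasure torusMeasure)
    {L : ℝ} (hexp : ∀ x y, ‖x - y‖ ≤ L * ‖f x - f y‖) (hL : 1 ≤ L) {κ : ℝ} (hκ : 0 < κ)
    (k₀ : Wave) (n : ℕ) :
    GradBound (pulse f κ k₀ n) ((512 * Real.pi ^ 2 * L ^ 4) ^ n * ‖waveVec k₀‖ ^ 2) := by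
  induction n with
  | zero => simpa using! gradBound_mFourier k₀
  | succ n ih =>
    rw [pulse_succ]
    refine ((ih.transfer hf hexp hL (continuous_pulse f hκ k₀ n)).of_norm_le
      (norm_mFourierCoeff_heat_le hκ _)).mono (le_of_eq (by ring))

/-- Only the heat flow loses mass, in proportion to the current gradient bound. The exponent `n + 1`
lets the geometric sum of losses be absorbed, as the ratio is at least 2. -/
theorem l2NormSq_pulse_ge {f : Torus ≃ Torus} (hf : MeasurePreserving f torusMeasure torusMeasure)
    {L : ℝ} (hexp : ∀ x y, ‖x - y‖ ≤ L * ‖f x - f y‖) (hL : 1 ≤ L) {κ : ℝ} (hκ : 0 < κ)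
    (k₀ : Wave) (n : ℕ) :
    1 - 8 * Real.pi ^ 2 * κ * ((512 * Real.pi ^ 2 * L ^ 4) ^ (n + 1) * ‖waveVec k₀‖ ^ 2) ≤
      l2NormSq (pulse f κ k₀ n) := by
  have hc := continuous_symm_of_expansion f (by linarith) hexp
  have hR : 2 ≤ 512 * Real.pi ^ 2 * L ^ 4 := by
    have h1 : 1 ≤ Real.pi ^ 2 := one_le_pow₀ (by linarith [Real.pi_gt_three])
    have h2 : 1 ≤ L ^ 4 := one_le_pow₀ hL
    nlinarith
  set R := 512 * Real.pi ^ 2 * L ^ 4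
  induction n with
  | zero =>
    have : l2NormSq (pulse f κ k₀ 0) = 1 := l2NormSq_mFourier k₀
    rw [this, sub_le_self_iff]
    positivity
  | succ n ih =>
    have hp := continuous_pulse f hκ k₀ n
    have h1 := l2NormSq_heat_ge hκ (hp.comp hc)
      ((gradBound_pulse hf hexp hL hκ k₀ n).transfer hf hexp hL hp)
    change l2NormSq (transfer f _) - _ ≤ l2NormSq (heat κ (transfer f _)) at h1
    rw [l2NormSq_transfer hf hc hp, ← pulse_succ] at h1
    have h2 : 0 ≤ 8 * Real.pi ^ 2 * κ * (R ^ (n + 1) * ‖waveVec k₀‖ ^ 2) := by positivity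
    have h3 : 8 * Real.pi ^ 2 * κ * (R ^ (n + 1 + 1) * ‖waveVec k₀‖ ^ 2) =
        R * (8 * Real.pi ^ 2 * κ * (R ^ (n + 1) * ‖waveVec k₀‖ ^ 2)) := by ring
    have h4 : 8 * Real.pi ^ 2 * κ * (R * (R ^ n * ‖waveVec k₀‖ ^ 2)) =
        8 * Real.pi ^ 2 * κ * (R ^ (n + 1) * ‖waveVec k₀‖ ^ 2) := by ring
    rw [h3]
    nlinarith

/-- The mean is preserved by volume-preserving transfer and by heat. The gradient cannot detect the
zero mode, so its absence has to be known separately. -/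
theorem mFourierCoeff_pulse_zero {f : Torus ≃ Torus}
    (hf : MeasurePreserving f torusMeasure torusMeasure) (hc : Continuous f.symm) {κ : ℝ}
    (hκ : 0 < κ) {k₀ : Wave} (hk₀ : k₀ ≠ 0) (n : ℕ) : mFourierCoeff (pulse f κ k₀ n) 0 = 0 := by
  induction n with
  | zero =>
    have := mFourierCoeff_mFourier k₀ 0
    rwa [if_neg hk₀.symm] at this
  | succ n ih =>
    rw [pulse_succ, mFourierCoeff_heat hκ,
      mFourierCoeff_transfer_zero hf hc (continuous_pulse f hκ k₀ n), ih, mul_zero]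

/-- One step of the comparison of a pulse with a pure mode. -/
theorem gradBound_step {f : Torus ≃ Torus} (hf : MeasurePreserving f torusMeasure torusMeasure)
    {L : ℝ} (hexp : ∀ x y, ‖x - y‖ ≤ L * ‖f x - f y‖) (hL : 1 ≤ L) {κ : ℝ} (hκ : 0 < κ)
    {g : Torus → ℂ} (hg : Continuous g) {a : ℂ} (ha : ‖a‖ ≤ 1) {k k' : Wave} {T E : ℝ}
    (hT : GradBound (fun x => g x - a * mFourier k x) T)
    (hE : GradBound (fun x => mFourier k (f.symm x) - mFourier k' x) E) :
    ∃ a' : ℂ, ‖a'‖ ≤ 1 ∧ GradBound (fun x => heat κ (transfer f g) x - a' * mFourier k' x)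
      (2 * (512 * Real.pi ^ 2 * L ^ 4 * T) + 2 * E) := by
  have hc := continuous_symm_of_expansion f (by linarith) hexp
  -- With this coefficient the new error is exactly the heat flow applied to `transfer f g - a *
  -- mFourier k'`, so no term in `κ` appears.
  refine ⟨damp κ k' * a, ?_, ?_⟩
  · rw [norm_mul, Complex.norm_real, Real.norm_of_nonneg (damp_pos κ k').le]
    exact mul_le_one₀ (damp_le_one hκ.le k') (norm_nonneg a) ha
  have h1 := hT.transfer hf hexp hL (by fun_prop)
  have h2 : GradBound (fun x => a * (mFourier k (f.symm x) - mFourier k' x)) E :=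
    hE.of_norm_le fun l => by
      rw [mFourierCoeff_const_mul, norm_mul]
      exact mul_le_of_le_one_left (norm_nonneg _) ha
  have h3 := h1.add h2 ((by fun_prop : Continuous fun x => g x - a * mFourier k x).comp hc)
    (by fun_prop)
  have e : (fun x => transfer f (fun x => g x - a * mFourier k x) x +
      a * (mFourier k (f.symm x) - mFourier k' x)) =
      fun x => transfer f g x - a * mFourier k' x := by
    ext x; simp only [PulseCat.transfer]; ring
  rw [e] at h3
  refine h3.of_norm_le fun l => ?_
  have ct : Continuous (transfer f g) := hg.comp hc
  rw [mFourierCoeff_sub (continuous_heat hκ _) (by fun_prop), mFourierCoeff_heat hκ,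
    mFourierCoeff_sub ct (by fun_prop), mFourierCoeff_const_mul, mFourierCoeff_const_mul,
    mFourierCoeff_mFourier]
  have e2 : (damp κ l : ℂ) * mFourierCoeff (transfer f g) l -
      damp κ k' * a * (if l = k' then 1 else 0) =
      damp κ l * (mFourierCoeff (transfer f g) l - a * (if l = k' then 1 else 0)) := by
    split_ifs with h
    · rw [h]; ring
    · ring
  rw [e2, norm_mul, Complex.norm_real, Real.norm_of_nonneg (damp_pos κ l).le]
  exact mul_le_of_le_one_left (norm_nonneg _) (damp_le_one hκ.le l)

/-- Old error and newly created error share the bound `E * W ^ n`, so one step multiplies it by `2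
(512 π² L⁴) + 2`, which `W` majorizes. -/
theorem exists_gradBound_pulse_sub {f : Torus ≃ Torus}
    (hf : MeasurePreserving f torusMeasure torusMeasure)
    {L : ℝ} (hexp : ∀ x y, ‖x - y‖ ≤ L * ‖f x - f y‖) (hL : 1 ≤ L) {κ : ℝ} (hκ : 0 < κ)
    {k : ℕ → Wave} {W E : ℝ} (hE0 : 0 ≤ E) (hW : 2 * (512 * Real.pi ^ 2 * L ^ 4) + 2 ≤ W)
    (hE : ∀ n, GradBound (fun x => mFourier (k n) (f.symm x) - mFourier (k (n + 1)) x)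
      (E * W ^ n)) (n : ℕ) :
    ∃ a : ℂ, ‖a‖ ≤ 1 ∧
      GradBound (fun x => pulse f κ (k 0) n x - a * mFourier (k n) x) (E * W ^ n) := by
  induction n with
  | zero =>
    refine ⟨1, by simp, fun S => ?_⟩
    have : (fun x => pulse f κ (k 0) 0 x - 1 * mFourier (k 0) x) = fun _ => 0 := by
      ext x; simp [pulse]
    rw [this]
    simp [mFourierCoeff, hE0]
  | succ n ih =>
    obtain ⟨a, ha, hT⟩ := ih
    obtain ⟨a', ha', hT'⟩ :=
      gradBound_step hf hexp hL hκ (continuous_pulse f hκ (k 0) n) ha hT (hE n)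
    refine ⟨a', ha', ?_⟩
    rw [pulse_succ]
    refine hT'.mono ?_
    have h0 : 0 ≤ E * W ^ n := hT.nonneg
    calc _ = E * W ^ n * (2 * (512 * Real.pi ^ 2 * L ^ 4) + 2) := by ring
      _ ≤ E * W ^ n * W := by gcongr
      _ = _ := by ring

/-! ### Spectral distributions -/

theorem waveVec_sub (k l : Wave) : waveVec (k - l) = waveVec k - waveVec l := by
  ext i; simp [waveVec]

theorem one_le_norm_waveVec_sq {k : Wave} (hk : k ≠ 0) : 1 ≤ ‖waveVec k‖ ^ 2 := by
  rw [norm_waveVec_sq]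
  have h : (1 : ℤ) ≤ k 0 ^ 2 + k 1 ^ 2 := by
    by_contra hlt
    have h0 : k 0 ^ 2 = 0 := by nlinarith [sq_nonneg (k 0), sq_nonneg (k 1)]
    have h1 : k 1 ^ 2 = 0 := by nlinarith [sq_nonneg (k 0), sq_nonneg (k 1)]
    refine hk (funext fun i => ?_)
    fin_cases i
    exacts [pow_eq_zero_iff two_ne_zero |>.1 h0, pow_eq_zero_iff two_ne_zero |>.1 h1]
  exact_mod_cast h

/-- Integrality lets a second moment control a first moment linearly, without the square root from
Cauchy–Schwarz. -/
theorem norm_waveVec_le_sq (k : Wave) : ‖waveVec k‖ ≤ ‖waveVec k‖ ^ 2 := by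
  by_cases hk : k = 0
  · subst hk
    have : waveVec 0 = 0 := by ext i; simp [waveVec]
    simp [this]
  · have h := one_le_norm_waveVec_sq hk
    have h1 : 1 ≤ ‖waveVec k‖ := by
      by_contra hlt
      nlinarith [norm_nonneg (waveVec k)]
    nlinarith

/-- A spectral distribution with second moment about the wavenumber `k` at most `V` has its centroid
within `V` of `k` and variance at most `V`. -/
theorem spectral_moments_of_hasSum {g : Torus → ℂ} (hg : Continuous g) (hpos : 0 < l2NormSq g)
    {k : Wave} {V : ℝ}
    (hV : HasSum (fun l => ‖waveVec l - waveVec k‖ ^ 2 * spectralMass g l) V) :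
    HasSpectralMoments g ∧ ‖centroid g - waveVec k‖ ≤ V ∧ spectralVariance g ≤ V := by
  have hp0 : ∀ l, 0 ≤ spectralMass g l := fun l => by unfold spectralMass; positivity
  have hp1 : HasSum (spectralMass g) 1 := by
    have := (hasSum_sq_mFourierCoeff_of_continuous hg).div_const (l2NormSq g)
    rwa [div_self hpos.ne'] at this
  have hle : ∀ l, ‖spectralMass g l • (waveVec l - waveVec k)‖ ≤
      ‖waveVec l - waveVec k‖ ^ 2 * spectralMass g l := fun l => by
    rw [norm_smul, Real.norm_of_nonneg (hp0 l), mul_comm, ← waveVec_sub]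
    exact mul_le_mul_of_nonneg_right (norm_waveVec_le_sq _) (hp0 l)
  have hs1 : Summable fun l => spectralMass g l • (waveVec l - waveVec k) :=
    Summable.of_norm_bounded hV.summable hle
  have hc : HasSum (fun l => spectralMass g l • waveVec l) (centroid g) := by
    have : Summable fun l => spectralMass g l • waveVec l := by
      refine (hs1.add (hp1.summable.smul_const (waveVec k))).congr fun l => ?_
      rw [smul_sub, sub_add_cancel]
    exact this.hasSum
  have hc' : HasSum (fun l => spectralMass g l • (waveVec l - waveVec k))
      (centroid g - waveVec k) := by
    have := hc.sub (hp1.smul_const (waveVec k))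
    simpa only [smul_sub, one_smul] using this
  refine ⟨⟨?_, hpos, ?_⟩, ?_, ?_⟩
  · exact hg.memLp_of_hasCompactSupport (HasCompactSupport.of_compactSpace g)
  · refine Summable.of_nonneg_of_le (fun l => by have := hp0 l; positivity) (fun l => ?_)
      ((hV.summable.mul_left 2).add (hp1.summable.mul_left (2 * ‖waveVec k‖ ^ 2)))
    have h1 : ‖waveVec l‖ ≤ ‖waveVec l - waveVec k‖ + ‖waveVec k‖ := by
      simpa using norm_add_le (waveVec l - waveVec k) (waveVec k)
    have h2 : ‖waveVec l‖ ^ 2 ≤ 2 * ‖waveVec l - waveVec k‖ ^ 2 + 2 * ‖waveVec k‖ ^ 2 := by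
      nlinarith [norm_nonneg (waveVec l), sq_nonneg (‖waveVec l - waveVec k‖ - ‖waveVec k‖)]
    nlinarith [hp0 l]
  · rw [← hc'.tsum_eq, ← hV.tsum_eq]
    exact tsum_of_norm_bounded hV.summable.hasSum hle
  · set d := centroid g - waveVec k with hd
    have hi : HasSum (fun l => inner ℝ d (spectralMass g l • (waveVec l - waveVec k)))
        (inner ℝ d d) := hc'.mapL (innerSL ℝ d)
    have hv : HasSum (fun l => ‖waveVec l - centroid g‖ ^ 2 * spectralMass g l)
        (V - 2 * inner ℝ d d + ‖d‖ ^ 2 * 1) := by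
      -- Parallel axis identity: the variance equals `V - ‖d‖²`.
      refine ((hV.sub (hi.mul_left 2)).add (hp1.mul_left (‖d‖ ^ 2))).congr_fun fun l => ?_
      have e : waveVec l - centroid g = (waveVec l - waveVec k) - d := by rw [hd]; abel
      rw [e, norm_sub_sq_real, inner_smul_right, real_inner_comm d]
      ring
    rw [spectralVariance, hv.tsum_eq, real_inner_self_eq_norm_sq]
    nlinarith [sq_nonneg ‖d‖]

/-- Mode `k` contributes nothing to the second moment about `k`, and off `k` the coefficients of `g`
are those of the error. For `l ≠ 0`, `1 ≤ ‖l‖` gives `‖l - k‖² ≤ 2 (1 + ‖k‖²) ‖l‖²`; the mass bound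
`1/2` supplies the other factor 2. -/
theorem spectral_moments_of_gradBound {g : Torus → ℂ} (hg : Continuous g)
    (hpos : 1 / 2 ≤ l2NormSq g) (h0 : mFourierCoeff g 0 = 0) {k : Wave} {a : ℂ} {T : ℝ}
    (hT : GradBound (fun x => g x - a * mFourier k x) T) :
    HasSpectralMoments g ∧ ‖centroid g - waveVec k‖ ≤ 4 * (1 + ‖waveVec k‖ ^ 2) * T ∧
      spectralVariance g ≤ 4 * (1 + ‖waveVec k‖ ^ 2) * T := by
  have hpos' : 0 < l2NormSq g := by linarith
  have hle : ∀ l, ‖waveVec l - waveVec k‖ ^ 2 * spectralMass g l ≤ 4 * (1 + ‖waveVec k‖ ^ 2) *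
      (‖waveVec l‖ ^ 2 * ‖mFourierCoeff (fun x => g x - a * mFourier k x) l‖ ^ 2) := by
    intro l
    by_cases hlk : l = k
    · subst hlk
      simp only [sub_self, norm_zero, ne_eq, OfNat.ofNat_ne_zero, not_false_eq_true, zero_pow,
        zero_mul]
      positivity
    rw [mFourierCoeff_sub hg (by fun_prop), mFourierCoeff_const_mul, mFourierCoeff_mFourier,
      if_neg hlk, mul_zero, sub_zero]
    by_cases hl0 : l = 0
    · subst hl0
      simp [spectralMass, h0]
    have h1 := one_le_norm_waveVec_sq hl0
    have h2 : ‖waveVec l - waveVec k‖ ^ 2 ≤ 2 * (1 + ‖waveVec k‖ ^ 2) * ‖waveVec l‖ ^ 2 := by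
      nlinarith [norm_sub_le (waveVec l) (waveVec k), norm_nonneg (waveVec l - waveVec k),
        sq_nonneg (‖waveVec l‖ - ‖waveVec k‖), sq_nonneg ‖waveVec k‖]
    have h3 : spectralMass g l ≤ 2 * ‖mFourierCoeff g l‖ ^ 2 := by
      rw [spectralMass, div_le_iff₀ hpos']
      nlinarith [sq_nonneg ‖mFourierCoeff g l‖]
    calc _ ≤ (2 * (1 + ‖waveVec k‖ ^ 2) * ‖waveVec l‖ ^ 2) * (2 * ‖mFourierCoeff g l‖ ^ 2) := by
          have : 0 ≤ spectralMass g l := by unfold spectralMass; positivity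
          gcongr
      _ = _ := by ring
  have hs : Summable fun l => ‖waveVec l - waveVec k‖ ^ 2 * spectralMass g l :=
    Summable.of_nonneg_of_le (fun l => by unfold spectralMass; positivity) hle
      (hT.summable.mul_left _)
  have hb : ∑' l, ‖waveVec l - waveVec k‖ ^ 2 * spectralMass g l ≤
      4 * (1 + ‖waveVec k‖ ^ 2) * T := by
    refine (hs.tsum_le_tsum hle (hT.summable.mul_left _)).trans ?_
    rw [tsum_mul_left]
    have := hT.tsum_le
    gcongr
  obtain ⟨h1, h2, h3⟩ := spectral_moments_of_hasSum hg hpos' hs.hasSum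
  exact ⟨h1, h2.trans hb, h3.trans hb⟩

/-! ### Growth of wavenumbers, the logarithmic time scale, closeness to the CAT map -/

theorem norm_waveVec_mulVec_sq_le (B : Matrix (Fin 2) (Fin 2) ℤ) (k : Wave) :
    ‖waveVec (B.mulVec k)‖ ^ 2 ≤ (1 + ∑ i, ∑ j, (B i j : ℝ) ^ 2) * ‖waveVec k‖ ^ 2 := by
  rw [norm_waveVec_sq, norm_waveVec_sq]
  simp only [Matrix.mulVec, dotProduct, Fin.sum_univ_two]
  push_cast
  -- Lagrange's identity for each row, that is, Cauchy–Schwarz.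
  nlinarith [sq_nonneg ((B 0 0 : ℝ) * k 1 - B 0 1 * k 0),
    sq_nonneg ((B 1 0 : ℝ) * k 1 - B 1 1 * k 0), sq_nonneg (k 0 : ℝ), sq_nonneg (k 1 : ℝ)]

theorem norm_waveVec_pow_mulVec_sq_le (B : Matrix (Fin 2) (Fin 2) ℤ) (k : Wave) (n : ℕ) :
    ‖waveVec ((B ^ n).mulVec k)‖ ^ 2 ≤ (1 + ∑ i, ∑ j, (B i j : ℝ) ^ 2) ^ n * ‖waveVec k‖ ^ 2 := by
  induction n with
  | zero => simp
  | succ n ih =>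
    rw [pow_succ' B, ← Matrix.mulVec_mulVec]
    refine (norm_waveVec_mulVec_sq_le B _).trans ?_
    rw [pow_succ' (1 + _), mul_assoc]
    gcongr

/-- Logarithmically many steps of exponential growth cost at most a square root. -/
theorem mul_pow_le_sqrt {R κ : ℝ} (hR : 1 < R) (hκ : 0 < κ) (hκ1 : κ ≤ 1) {n : ℕ}
    (hn : (n : ℝ) ≤ 1 / (2 * Real.log R) * (|Real.log κ| + 1)) : κ * R ^ n ≤ 2 * √κ := by
  have hl : 0 < Real.log R := Real.log_pos hR
  have hk : |Real.log κ| = -Real.log κ := abs_of_nonpos (Real.log_nonpos hκ.le hκ1)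
  -- So `R ^ n ≤ exp (1/2) / √κ`, with `exp (1/2) ≤ 2` coming from the `+ 1` in the time bound.
  have h1 : n * Real.log R ≤ 1 / 2 - Real.log κ / 2 := by
    rw [hk] at hn
    calc n * Real.log R ≤ 1 / (2 * Real.log R) * (-Real.log κ + 1) * Real.log R := by gcongr
      _ = _ := by field_simp; ring
  have h2 : κ * R ^ n = Real.exp (Real.log κ + n * Real.log R) := by
    rw [Real.exp_add, Real.exp_log hκ, Real.exp_nat_mul, Real.exp_log (by linarith)]
  have h3 : √κ = Real.exp (Real.log κ / 2) := by
    rw [Real.sqrt_eq_rpow, Real.rpow_def_of_pos hκ]; ring_nf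
  have h4 : Real.exp (1 / 2) ≤ 2 := by
    have h5 : Real.exp (1 / 2) ^ 2 = Real.exp 1 := by
      rw [← Real.exp_nat_mul]; norm_num
    nlinarith [Real.exp_one_lt_d9, Real.exp_pos (1 / 2)]
  rw [h2, h3]
  calc _ ≤ Real.exp (1 / 2 + Real.log κ / 2) := Real.exp_le_exp.2 (by linarith)
    _ = Real.exp (1 / 2) * Real.exp (Real.log κ / 2) := Real.exp_add _ _
    _ ≤ _ := by gcongr

/-- A map at distance `ε` from a CAT map differs from it by a bounded and Lipschitz map of size
`O(ε)`. -/
theorem near_catMap {A : Matrix (Fin 2) (Fin 2) ℤ} {f : Torus → Torus} (hf : IsSmooth f)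
    {ε : ℝ} (hε : ε ≤ 1 / 4) (h : cInftyDist f (catMap A) ≤ ε) :
    (∀ x, ‖f x - catMap A x‖ ≤ 8 * ε) ∧
      ∀ x y, ‖(f x - catMap A x) - (f y - catMap A y)‖ ≤ 8 * ε * ‖x - y‖ := by
  have h1 := cDist_one_le hε h
  have h0 := cDist_nonneg f (catMap A) 1
  refine ⟨fun x => ?_, fun x y => ?_⟩
  · refine (norm_sub_le_c0Dist f (catMap A) x).trans ?_
    have : c0Dist f (catMap A) ≤ cDist f (catMap A) 1 := cDist_mono f (catMap A) zero_le_one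
    linarith
  · refine (norm_sub_sub_sub_le hf (isSmooth_catMap A) x y).trans ?_
    nlinarith [norm_nonneg (x - y)]

end PulseCat

/-! ### Choice of constants and conclusion -/

open PulseCat in
theorem mainTheorem8 (A : Matrix (Fin 2) (Fin 2) ℤ) (hA : PulseCat.IsHyperbolic A) :
    ∃ M : ℝ, 1 < M ∧ ∃ c : ℝ, 0 < c ∧
      ∀ k₀ : PulseCat.Wave, k₀ ≠ 0 →
        ∃ η₀ : ℝ, 0 < η₀ ∧ ∃ C : ℝ, 0 < C ∧
          ∀ ε κ : ℝ, 0 < ε → ε ≤ η₀ → 0 < κ → κ ≤ η₀ →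
            ∀ f : PulseCat.Torus ≃ PulseCat.Torus, PulseCat.IsSmoothDiffeo f →
              MeasureTheory.MeasurePreserving f PulseCat.torusMeasure PulseCat.torusMeasure →
              PulseCat.cInftyDist f (PulseCat.catMap A) ≤ ε →
              ∀ n : ℕ, (n : ℝ) ≤ c * (|Real.log κ| + 1) →
                PulseCat.HasSpectralMoments (PulseCat.pulse f κ k₀ n) ∧
                ‖PulseCat.centroid (PulseCat.pulse f κ k₀ n) -
                    PulseCat.waveVec ((A⁻¹.transpose ^ n).mulVec k₀)‖ ≤ C * (max κ ε * M ^ n) ∧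
                PulseCat.spectralVariance (PulseCat.pulse f κ k₀ n) ≤ C * (max κ ε * M ^ n) := by
  -- A unit determinant makes `A⁻¹` a genuine integer inverse rather than the default 0.
  have hdet : IsUnit A.det := by
    rcases hA.1 with h | h <;> rw [h]
    exacts [isUnit_one, isUnit_one.neg]
  have hinv : A⁻¹ * A = 1 := Matrix.nonsing_inv_mul A hdet
  set B := A⁻¹.transpose with hB
  have hAB : A.transpose * B = 1 := by
    rw [hB, ← Matrix.transpose_mul, hinv, Matrix.transpose_one]
  obtain ⟨b, hb_eq⟩ : ∃ b : ℝ, b = ∑ i, ∑ j, |(A⁻¹ i j : ℝ)| := ⟨_, rfl⟩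
  obtain ⟨β, hβ_eq⟩ : ∃ β : ℝ, β = 1 + ∑ i, ∑ j, (B i j : ℝ) ^ 2 := ⟨_, rfl⟩
  have hb0 : 0 ≤ b := by
    rw [hb_eq]; exact Finset.sum_nonneg fun i _ => Finset.sum_nonneg fun j _ => abs_nonneg _
  have hβ1 : 1 ≤ β := by
    rw [hβ_eq, le_add_iff_nonneg_right]
    exact Finset.sum_nonneg fun i _ => Finset.sum_nonneg fun j _ => sq_nonneg _
  obtain ⟨L, hL_eq⟩ : ∃ L : ℝ, L = 2 * b + 1 := ⟨_, rfl⟩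
  have hL : 1 ≤ L := by linarith
  obtain ⟨R, hR_eq⟩ : ∃ R : ℝ, R = 512 * Real.pi ^ 2 * L ^ 4 := ⟨_, rfl⟩
  have hR : 2 ≤ R := by
    have h1 : 1 ≤ Real.pi ^ 2 := one_le_pow₀ (by linarith [Real.pi_gt_three])
    have h2 : 1 ≤ L ^ 4 := one_le_pow₀ hL
    rw [hR_eq]
    nlinarith
  -- `2 * R + 2` drives the error recursion; `β ^ 2` bounds the growth of `‖k n‖² ‖k (n + 1)‖²` in
  -- the newly created error.
  obtain ⟨W, hW_eq⟩ : ∃ W : ℝ, W = 2 * R + 2 + β ^ 2 := ⟨_, rfl⟩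
  have hW : 2 * R + 2 ≤ W := by rw [hW_eq]; linarith [sq_nonneg β]
  have hβW : β ^ 2 ≤ W := by linarith
  have hlog : 0 < Real.log R := Real.log_pos (by linarith)
  -- In `M = β * W` the extra `β` pays for the factor `1 + ‖k n‖²` in the moment bounds; the choice
  -- of `c` makes `κ * R ^ n ≤ 2 * √κ`.
  refine ⟨β * W, by nlinarith, 1 / (2 * Real.log R), by positivity, fun k₀ hk₀ => ?_⟩
  have hG := one_le_norm_waveVec_sq hk₀
  obtain ⟨G, hG_eq⟩ : ∃ G : ℝ, G = ‖waveVec k₀‖ ^ 2 := ⟨_, rfl⟩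
  rw [← hG_eq] at hG
  have hπ := Real.pi_pos
  obtain ⟨E, hE_eq⟩ : ∃ E : ℝ, E = 8 * Real.pi ^ 2 * (β * G) * ((16 * Real.pi ^ 2 + 2) * G) *
    64 * L ^ 2 := ⟨_, rfl⟩
  have hE : 0 < E := by rw [hE_eq]; positivity
  obtain ⟨s, hs_eq⟩ : ∃ s : ℝ, s = 1 / (32 * Real.pi ^ 2 * G * R) := ⟨_, rfl⟩
  have hs : 0 < s := by rw [hs_eq]; positivity
  -- The three thresholds serve the inversion of the `C^∞` distance, the condition `b * (8 * ε) ≤ 1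
  -- / 2` for the Lipschitz bound on `f⁻¹`, and a mass loss of at most `1/2`, for which `s` is
  -- chosen.
  refine ⟨min (min (1 / 4) (1 / (16 * (b + 1)))) (s ^ 2), by positivity, 8 * G * E, by positivity,
    fun ε κ hε0 hε hκ0 hκ f hfs hfm hd n hn => ?_⟩
  have hε4 : ε ≤ 1 / 4 := hε.trans ((min_le_left _ _).trans (min_le_left _ _))
  have hεb : ε ≤ 1 / (16 * (b + 1)) := hε.trans ((min_le_left _ _).trans (min_le_right _ _))
  have hκ4 : κ ≤ 1 / 4 := hκ.trans ((min_le_left _ _).trans (min_le_left _ _))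
  have hκs : √κ ≤ s := Real.sqrt_le_iff.2 ⟨hs.le, hκ.trans (min_le_right _ _)⟩
  obtain ⟨hsup, hlip⟩ := near_catMap hfs.1 hε4 hd
  have hexp : ∀ x y, ‖x - y‖ ≤ L * ‖f x - f y‖ := fun x y => by
    have hbε : b * (8 * ε) ≤ 1 / 2 := by
      rw [le_div_iff₀ (by positivity)] at hεb
      nlinarith
    have h1 := norm_sub_le_of_near_catMap hinv (b := b)
      (fun x => hb_eq ▸ norm_catMap_le A⁻¹ x) hb0 hlip hbε x y
    refine h1.trans ?_
    gcongr
    linarith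
  have hc := continuous_symm_of_expansion f (by linarith) hexp
  set k : ℕ → Wave := fun n => (B ^ n).mulVec k₀ with hk
  have hk0 : k 0 = k₀ := by
    rw [hk]; simp only [pow_zero, Matrix.one_mulVec]
  have hkn : ∀ n, ‖waveVec (k n)‖ ^ 2 ≤ β ^ n * G := fun n => by
    rw [hβ_eq, hG_eq]; exact norm_waveVec_pow_mulVec_sq_le B k₀ n
  have hksucc : ∀ n, A.transpose.mulVec (k (n + 1)) = k n := fun n => by
    simp only [hk]
    rw [Matrix.mulVec_mulVec, pow_succ' B, ← mul_assoc, hAB, one_mul]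
  have hmode : ∀ n, GradBound (fun x => UnitAddTorus.mFourier (k n) (f.symm x) -
      UnitAddTorus.mFourier (k (n + 1)) x) (E * ε ^ 2 * W ^ n) := by
    intro n
    refine (gradBound_mode_transfer_sub f (by positivity) (by linarith) hsup hlip hexp
      (hksucc n)).mono ?_
    have h1 : 1 ≤ β ^ n := one_le_pow₀ hβ1
    have h2 : 16 * Real.pi ^ 2 * ‖waveVec (k n)‖ ^ 2 + 2 ≤ (16 * Real.pi ^ 2 + 2) * (β ^ n * G) := by
      have h3 : 1 ≤ β ^ n * G := one_le_mul_of_one_le_of_one_le h1 hG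
      have h4 : 16 * Real.pi ^ 2 * ‖waveVec (k n)‖ ^ 2 ≤ 16 * Real.pi ^ 2 * (β ^ n * G) := by
        gcongr; exact hkn n
      linarith
    calc _ ≤ 8 * Real.pi ^ 2 * (β ^ (n + 1) * G) * ((16 * Real.pi ^ 2 + 2) * (β ^ n * G)) *
          (8 * ε) ^ 2 * L ^ 2 := by gcongr; exact hkn (n + 1)
      _ = E * ε ^ 2 * (β ^ 2) ^ n := by rw [hE_eq]; ring
      _ ≤ _ := by gcongr
  obtain ⟨a, -, hT⟩ := exists_gradBound_pulse_sub hfm hexp hL hκ0 (k := k) (W := W)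
    (E := E * ε ^ 2) (by positivity) (by rw [← hR_eq]; exact hW) hmode n
  rw [hk0] at hT
  have hmass : 1 / 2 ≤ l2NormSq (pulse f κ k₀ n) := by
    refine le_trans ?_ (l2NormSq_pulse_ge hfm hexp hL hκ0 k₀ n)
    rw [← hR_eq, ← hG_eq]
    have h1 := mul_pow_le_sqrt (by linarith) hκ0 (by linarith) hn
    have h2 : 8 * Real.pi ^ 2 * κ * (R ^ (n + 1) * G) ≤ 8 * Real.pi ^ 2 * G * R * (2 * s) := by
      calc _ = 8 * Real.pi ^ 2 * G * R * (κ * R ^ n) := by ring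
        _ ≤ _ := mul_le_mul_of_nonneg_left (h1.trans (by gcongr)) (by positivity)
    have h3 : 8 * Real.pi ^ 2 * G * R * (2 * s) = 1 / 2 := by
      rw [hs_eq]; field_simp; norm_num
    linarith
  have hfinal : 4 * (1 + ‖waveVec (k n)‖ ^ 2) * (E * ε ^ 2 * W ^ n) ≤
      8 * G * E * (max κ ε * (β * W) ^ n) := by
    have h1 : 1 ≤ β ^ n * G := one_le_mul_of_one_le_of_one_le (one_le_pow₀ hβ1) hG
    -- The error is in fact quadratic in `ε`; `ε ≤ 1` reduces it to the stated form.
    have h2 : ε ^ 2 ≤ max κ ε := le_trans (by nlinarith) (le_max_right κ ε)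
    have hW0 : 0 ≤ W := by linarith
    calc _ ≤ 4 * (β ^ n * G + β ^ n * G) * (E * max κ ε * W ^ n) := by
          gcongr; exact hkn n
      _ = _ := by rw [mul_pow]; ring
  obtain ⟨h1, h2, h3⟩ := spectral_moments_of_gradBound (continuous_pulse f hκ0 k₀ n) hmass
    (mFourierCoeff_pulse_zero hfm hc hκ0 hk₀ n) hT
  exact ⟨h1, h2.trans hfinal, h3.trans hfinal⟩
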